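/- Let $p \equiv 1 \pmod 3$ be a prime, $\zeta_p$ a primitive $p$-th root of unity, $K$ the unique cubic subfield of $\mathbb{Q}(\zeta_p)$, and $\theta := \mathrm{tr}_{\mathbb{Q}(\zeta_p)/K}(\zeta_p - 1) \in K$. Let $a_1, a_2, d_1, d_2$ be integers and let $X \subset \mathbf{P}^3_{\mathbb{Q}}$ be the cubic surface $$T_3(a_1T_0+d_1T_3)(a_2T_0+d_2T_3) = \prod_{\sigma \in \mathrm{Gal}(K/\mathbb{Q})} \big(T_0 + \sigma(\theta)T_1 + \sigma(\theta)^2T_2\big) = N_{K/\mathbb{Q}}(T_0+\theta T_1+\theta^2T_2).$$ (i) $X$ has an equation with coprime integer coefficients whose reduction modulo $p$ is $$T_3(a_1T_0+d_1T_3)(a_2T_0+d_2T_3) = T_0^3.$$ Over $\overline{\mathbb{F}}_p$, the reduction $X_p$ is the union of three planes (counted with multiplicity). If $p \nmid d_1d_2$, then these are $T_3 = s_1T_0$, $T_3 = s_2T_0$, $T_3 = s_3T_0$, where $s_1, s_2, s_3 \in \overline{\mathbb{F}}_p$ are the zeroes, with multiplicity, of $T(a_1+d_1T)(a_2+d_2T)-1$.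 In general, if this polynomial has degree $k \le 3$ over $\overline{\mathbb{F}}_p$, leading coefficient $c$ and zeroes $s_1, \dots, s_k$ with multiplicity, then $X_p$ is given by $c\,T_0^{3-k}\prod_{j=1}^k (T_3 - s_jT_0) = 0$; that is, each zero at infinity contributes the plane $T_0 = 0$. (ii) Suppose $p \nmid d_1d_2$ and $\gcd(d_1,d_2)=1$. Then for every $(t_0:t_1:t_2:t_3) \in X(\mathbb{Q})$ we have $t_0 \neq 0$, the fraction $t_3/t_0$ is $p$-integral, its reduction $s := (t_3/t_0 \bmod p) \in \mathbb{F}_p$ is a nonzero root of $T(a_1+d_1T)(a_2+d_2T)-1$, and $\frac{a_1+d_1s}{s}$ is a cube in $\mathbb{F}_p^*$. In particular, if $\frac{a_1+d_1s}{s}$ is a non-cube for every root $s \in \mathbb{F}_p$ of $T(a_1+d_1T)(a_2+d_2T)-1$, then $X(\mathbb{Q}) = \emptyset$. (iii) Suppose that $p \nmid d_1d_2$, that every prime number dividing $\gcd(a_1,d_1)$ or $\gcd(a_2,d_2)$ splits completely in $K$, and that $T(a_1+d_1T)(a_2+d_2T)-1$ has at least one simple zero in $\mathbb{F}_p$. Then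 $X(\mathbb{A}_{\mathbb{Q}}) \neq \emptyset$, where $\mathbb{A}_{\mathbb{Q}}$ is the ring of adeles of $\mathbb{Q}$. Consequently, if the hypotheses of (ii) and (iii) hold and $\frac{a_1+d_1s}{s}$ is a non-cube for every root $s \in \mathbb{F}_p$, then $X$ is a counterexample to the Hasse principle: $X(\mathbb{A}_{\mathbb{Q}}) \neq \emptyset$ and $X(\mathbb{Q}) = \emptyset$. -/

import Mathlib

open scoped NumberField

/-- A subfield of a cyclotomic field is Galois over `ℚ`. -/
instance cyclotomicSubfieldIsGalois (p : ℕ) [Fact p.Prime]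
    (K : IntermediateField ℚ (CyclotomicField p ℚ)) : IsGalois ℚ K := by
  have : NeZero (p : ℚ) := ⟨Nat.cast_ne_zero.2 (Fact.out : p.Prime).ne_zero⟩
  have : IsCyclotomicExtension {p} ℚ (CyclotomicField p ℚ) :=
    CyclotomicField.isCyclotomicExtension p ℚ
  have : IsAbelianGalois ℚ (CyclotomicField p ℚ) :=
    IsCyclotomicExtension.isAbelianGalois {p} ℚ (CyclotomicField p ℚ)
  have := IsAbelianGalois.tower_bot ℚ K (CyclotomicField p ℚ)
  exact this.toIsGalois

instance cyclotomicSubfieldNumberField (p : ℕ) [Fact p.Prime]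
    (K : IntermediateField ℚ (CyclotomicField p ℚ)) : NumberField K := by
  have : NeZero (p : ℚ) := ⟨Nat.cast_ne_zero.2 (Fact.out : p.Prime).ne_zero⟩
  have : IsCyclotomicExtension {p} ℚ (CyclotomicField p ℚ) :=
    CyclotomicField.isCyclotomicExtension p ℚ
  have : NumberField (CyclotomicField p ℚ) :=
    IsCyclotomicExtension.numberField {p} ℚ (CyclotomicField p ℚ)
  infer_instance

namespace MordellSurface

noncomputable section

open MvPolynomial

/-- The product `∏_σ (T₀ + σ(θ) T₁ + σ(θ)² T₂)` over the Galois group of `K / k`. -/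
def conjugateProduct (k : Type*) {K : Type*} [Field k] [Field K] [Algebra k K]
    [FiniteDimensional k K] (θ : K) : MvPolynomial (Fin 4) K :=
  ∏ σ : K ≃ₐ[k] K, (X 0 + C (σ θ) * X 1 + C ((σ θ) ^ 2) * X 2)

/-- The product of the conjugates has coefficients in the base field. -/
theorem exists_normForm (k : Type*) {K : Type*} [Field k] [Field K] [Algebra k K]
    [FiniteDimensional k K] [IsGalois k K] (θ : K) :
    ∃ N : MvPolynomial (Fin 4) k, map (algebraMap k K) N = conjugateProduct k θ := by
  have key : ∀ τ : K ≃ₐ[k] K,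
      map (τ : K →+* K) (conjugateProduct k θ) = conjugateProduct k θ := by
    intro τ
    unfold conjugateProduct
    rw [map_prod]
    refine Fintype.prod_equiv (Equiv.mulLeft τ) _ _ fun σ => ?_
    simp
  have h : conjugateProduct k θ ∈ (map (σ := Fin 4) (algebraMap k K)).range := by
    rw [← SetLike.mem_coe, RingHom.coe_range, mem_range_map_iff_coeffs_subset]
    intro c hc
    obtain ⟨m, -, rfl⟩ := mem_coeffs_iff.1 hc
    rw [IsGalois.mem_range_algebraMap_iff_fixed]
    intro τ
    have := congrArg (coeff m) (key τ)
    rwa [coeff_map] at this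
  exact h

/-- The norm form `N_{K/k}(T₀ + θ T₁ + θ² T₂)`, a polynomial over `k`: the unique one that becomes
the product of the conjugates over `K`. -/
def normForm (k : Type*) {K : Type*} [Field k] [Field K] [Algebra k K]
    [FiniteDimensional k K] [IsGalois k K] (θ : K) : MvPolynomial (Fin 4) k :=
  (exists_normForm k θ).choose

theorem map_normForm (k : Type*) {K : Type*} [Field k] [Field K] [Algebra k K]
    [FiniteDimensional k K] [IsGalois k K] (θ : K) :
    map (algebraMap k K) (normForm k θ) = conjugateProduct k θ :=
  (exists_normForm k θ).choose_spec

/-- The form `T₃ (a₁ T₀ + d₁ T₃) (a₂ T₀ + d₂ T₃)` over `R`. -/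
def splitForm (R : Type*) [CommRing R] (a₁ a₂ d₁ d₂ : ℤ) : MvPolynomial (Fin 4) R :=
  X 3 * (C (a₁ : R) * X 0 + C (d₁ : R) * X 3) * (C (a₂ : R) * X 0 + C (d₂ : R) * X 3)

/-- The form whose vanishing is the equation
`T₃ (a₁ T₀ + d₁ T₃) (a₂ T₀ + d₂ T₃) = N_{K/ℚ}(T₀ + θ T₁ + θ² T₂)` of the cubic surface. -/
def surfaceForm {K : Type*} [Field K] [Algebra ℚ K] [FiniteDimensional ℚ K] [IsGalois ℚ K]
    (θ : K) (a₁ a₂ d₁ d₂ : ℤ) : MvPolynomial (Fin 4) ℚ :=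
  splitForm ℚ a₁ a₂ d₁ d₂ - normForm ℚ θ

/-- The polynomial `T (a₁ + d₁ T) (a₂ + d₂ T) - 1` over `R`. -/
def rootPoly (R : Type*) [CommRing R] (a₁ a₂ d₁ d₂ : ℤ) : Polynomial R :=
  Polynomial.X * (Polynomial.C (a₁ : R) + Polynomial.C (d₁ : R) * Polynomial.X) *
    (Polynomial.C (a₂ : R) + Polynomial.C (d₂ : R) * Polynomial.X) - 1

/-- Homogeneous coordinate vectors of `R`-valued points of the hypersurface `F = 0` in `ℙ³`:
the coordinates generate the unit ideal of `R` (over a field: they are not all zero) and satisfy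
the equation. -/
def coordinates {A : Type*} [CommRing A] (F : MvPolynomial (Fin 4) A) (R : Type*) [CommRing R]
    [Algebra A R] : Set (Fin 4 → R) :=
  {t | Ideal.span (Set.range t) = ⊤ ∧ aeval t F = 0}

/-- The `R`-valued points of the hypersurface `F = 0` in `ℙ³`, as homogeneous coordinate vectors
up to multiplication by units of `R`. This describes all `R`-valued points as soon as every line
bundle on `Spec R` is trivial, as it is for fields and for the ring of adeles of `ℚ`. -/
def points {A : Type*} [CommRing A] (F : MvPolynomial (Fin 4) A) (R : Type*) [CommRing R]
    [Algebra A R] : Set (MulAction.orbitRel.Quotient Rˣ (Fin 4 → R)) :=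
  Quotient.mk (MulAction.orbitRel Rˣ (Fin 4 → R)) '' coordinates F R

/-- `G` is an equation with coprime integer coefficients of the rational hypersurface `F = 0`; the
reduction of the hypersurface at a prime `p` is then given by `G mod p`. -/
def IsPrimitiveModel (F : MvPolynomial (Fin 4) ℚ) (G : MvPolynomial (Fin 4) ℤ) : Prop :=
  map (Int.castRingHom ℚ) G = F ∧ ∀ n : ℤ, C n ∣ G → IsUnit n

/-- The prime `q` decomposes in `K`: there are `[K : ℚ]` primes of `K` above it. -/
def Decomposes (q : ℕ) (K : Type*) [Field K] [NumberField K] : Prop :=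
  ((Ideal.span {(q : ℤ)}).primesOver (𝓞 K)).ncard = Module.finrank ℚ K

end

end MordellSurface

/-!
Let `e = (p - 1) / 3`, so that the cubes in `(ℤ/p)ˣ` are the `e`-torsion. The conjugates of `θ` are
the Gaussian periods `∑_h (ζ ^ (g h) - 1)`, with `h` running through the cubes
(`exists_algebraMap_conj_eq`), and the surface is given by the cubic form `surfaceValue` whose norm
part `cubicNorm` has the elementary symmetric functions `e₁, e₂, e₃ ∈ ℤ` of the periods as
parameters. Let `f = T³ - e₁ T² + e₂ T - e₃`. Four properties of `f` carry the proof.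

* `f` is Eisenstein at `p`. Modulo `p` one may replace `ζ` by `1`, so `p` divides all `eᵢ`; and
  `p² ∤ e₃`, because a period has `(ζ - 1)`-adic valuation at most `e`: the operator `X d/dX`,
  applied `e` times, shows that its polynomial has a zero of order at most `e` at `1` modulo `p`
  (`not_pow_dvd_periodPoly`).
* If `q ≠ p` is a prime which is not a cube modulo `p`, then `f` has no root modulo `q`: the
  Frobenius permutes the three periods in characteristic `q` transitively, and by Fourier inversion
  they are not all equal (`not_forall_period_eq`, `period_pow_ne`).
* If `q ≠ p` is a cube modulo `p`, then `f` has a root in `ℤ_q`, the period of a Teichmüller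
  representative, which is fixed by the Frobenius of the Witt vectors
  (`IsPeriodCubic.exists_padicInt_root`).
* If `q` decomposes in `K`, then `f` has a root modulo `q` (`exists_root_zmod_of_decomposes`).

By the first property the norm form is `T₀³` modulo `p`, whence the three planes. It also forces
`p ∤ t₀` at a rational point in primitive integral coordinates (`not_dvd_of_eisenstein`). For `q` as
in the second property the norm form is anisotropic modulo `q`, so its values have `q`-adic
valuation divisible by `3`. As `d₁` and `d₂` are coprime, comparison of the valuations of the two
sides of the equation shows that `(a₁ t₀ + d₁ t₃) t₃²` is, up to cubes, a product of primes that are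
cubes modulo `p`. Hence it is a cube modulo `p` (`cube_of_primitive_point`).

For the adelic points it suffices to find points over `ℝ`, where `T (a₁ + d₁ T) (a₂ + d₂ T) - 1` has
a zero, and over all `ℤ_q` (`hasPoint_adeleRing`). At `p` the simple zero lifts. At the cubes modulo
`p` a root of `f` gives a point on `T₃ = 0`. At any other prime `q`, Hensel's lemma applies to a
smooth point modulo `q`. If `q ∣ d₁ d₂`, such a point is written down, using that `q` divides
neither both `a₁, d₁` nor both `a₂, d₂`, as it would otherwise decompose in `K`. If `q ∤ d₁ d₂`, the
theorem of Chevalley and Warning gives a point, and a suitable line through it a smooth one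
(`exists_smooth_point_zmod`).
-/

namespace MordellSurface

section

open Polynomial

/-! ### The norm form of a cubic -/

/-- The product `∏ᵢ (x + rᵢ y + rᵢ² z)` over the three roots `rᵢ` of `T³ - e₁ T² + e₂ T - e₃`,
written in terms of the elementary symmetric functions of the roots. -/
def cubicNorm {R : Type*} [CommRing R] (e₁ e₂ e₃ x y z : R) : R :=
  x ^ 3 + e₁ * x ^ 2 * y + (e₁ ^ 2 - 2 * e₂) * x ^ 2 * z + e₂ * x * y ^ 2 +
    (e₁ * e₂ - 3 * e₃) * x * y * z + (e₂ ^ 2 - 2 * e₁ * e₃) * x * z ^ 2 + e₃ * y ^ 3 +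
    e₁ * e₃ * y ^ 2 * z + e₂ * e₃ * y * z ^ 2 + e₃ ^ 2 * z ^ 3

/-- The partial derivative of `cubicNorm` in the second coordinate. -/
def cubicNormDerivY {R : Type*} [CommRing R] (e₁ e₂ e₃ x y z : R) : R :=
  e₁ * x ^ 2 + 2 * e₂ * x * y + (e₁ * e₂ - 3 * e₃) * x * z + 3 * e₃ * y ^ 2 +
    2 * e₁ * e₃ * y * z + e₂ * e₃ * z ^ 2

/-- The partial derivative of `cubicNorm` in the third coordinate. -/
def cubicNormDerivZ {R : Type*} [CommRing R] (e₁ e₂ e₃ x y z : R) : R :=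
  (e₁ ^ 2 - 2 * e₂) * x ^ 2 + (e₁ * e₂ - 3 * e₃) * x * y + 2 * (e₂ ^ 2 - 2 * e₁ * e₃) * x * z +
    e₁ * e₃ * y ^ 2 + 2 * e₂ * e₃ * y * z + 3 * e₃ ^ 2 * z ^ 2

theorem map_cubicNorm {R S : Type*} [CommRing R] [CommRing S] (φ : R →+* S)
    (e₁ e₂ e₃ x y z : R) :
    φ (cubicNorm e₁ e₂ e₃ x y z) = cubicNorm (φ e₁) (φ e₂) (φ e₃) (φ x) (φ y) (φ z) := by
  simp [cubicNorm, map_ofNat]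

theorem cubicNorm_eq_mul {R : Type*} [CommRing R] {e₁ e₂ e₃ r₁ r₂ r₃ : R}
    (h₁ : e₁ = r₁ + r₂ + r₃) (h₂ : e₂ = r₁ * r₂ + r₁ * r₃ + r₂ * r₃) (h₃ : e₃ = r₁ * r₂ * r₃)
    (x y z : R) :
    cubicNorm e₁ e₂ e₃ x y z =
      (x + r₁ * y + r₁ ^ 2 * z) * (x + r₂ * y + r₂ ^ 2 * z) * (x + r₃ * y + r₃ ^ 2 * z) := by
  subst h₁ h₂ h₃
  simp only [cubicNorm]
  ring

/-- The monic cubic `T³ - e₁ T² + e₂ T - e₃`. -/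
noncomputable def monicCubic {R : Type*} [CommRing R] (e₁ e₂ e₃ : R) : R[X] :=
  X ^ 3 - C e₁ * X ^ 2 + C e₂ * X - C e₃

theorem monicCubic_eq_toPoly {R : Type*} [CommRing R] (e₁ e₂ e₃ : R) :
    monicCubic e₁ e₂ e₃ = Cubic.toPoly ⟨1, -e₁, e₂, -e₃⟩ := by
  simp [monicCubic, Cubic.toPoly]
  ring

theorem eval_monicCubic {R : Type*} [CommRing R] (e₁ e₂ e₃ r : R) :
    (monicCubic e₁ e₂ e₃).eval r = r ^ 3 - e₁ * r ^ 2 + e₂ * r - e₃ := by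
  simp [monicCubic]

theorem eval_monicCubic_eq_mul {R : Type*} [CommRing R] {e₁ e₂ e₃ r₁ r₂ r₃ : R}
    (h₁ : e₁ = r₁ + r₂ + r₃) (h₂ : e₂ = r₁ * r₂ + r₁ * r₃ + r₂ * r₃) (h₃ : e₃ = r₁ * r₂ * r₃)
    (r : R) : (monicCubic e₁ e₂ e₃).eval r = (r - r₁) * (r - r₂) * (r - r₃) := by
  subst h₁ h₂ h₃
  rw [eval_monicCubic]
  ring

section Field

variable {F : Type*} [Field F] {e₁ e₂ e₃ : F}

theorem monicCubic_natDegree : (monicCubic e₁ e₂ e₃).natDegree = 3 := by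
  rw [monicCubic_eq_toPoly]
  exact Cubic.natDegree_of_a_ne_zero one_ne_zero

theorem monicCubic_monic : (monicCubic e₁ e₂ e₃).Monic := by
  rw [monicCubic_eq_toPoly, Polynomial.Monic]
  exact Cubic.leadingCoeff_of_a_ne_zero one_ne_zero

theorem monicCubic_irreducible (hf : ∀ r : F, (monicCubic e₁ e₂ e₃).eval r ≠ 0) :
    Irreducible (monicCubic e₁ e₂ e₃) := by
  refine Polynomial.irreducible_of_degree_le_three_of_not_isRoot ?_ hf
  rw [monicCubic_natDegree]
  decide

theorem exists_roots_monicCubic (e₁ e₂ e₃ : F) : ∃ r₁ r₂ r₃ : AlgebraicClosure F,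
    algebraMap F (AlgebraicClosure F) e₁ = r₁ + r₂ + r₃ ∧
    algebraMap F (AlgebraicClosure F) e₂ = r₁ * r₂ + r₁ * r₃ + r₂ * r₃ ∧
    algebraMap F (AlgebraicClosure F) e₃ = r₁ * r₂ * r₃ ∧
    ((monicCubic e₁ e₂ e₃).map (algebraMap F (AlgebraicClosure F))).roots = {r₁, r₂, r₃} := by
  have hP := IsAlgClosed.splits
    ((Cubic.toPoly ⟨1, -e₁, e₂, -e₃⟩).map (algebraMap F (AlgebraicClosure F)))
  obtain ⟨r₁, r₂, r₃, h⟩ := (Cubic.splits_iff_roots_eq_three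
    (P := (⟨1, -e₁, e₂, -e₃⟩ : Cubic F)) (φ := algebraMap F (AlgebraicClosure F))
    one_ne_zero).1 hP
  have hb := Cubic.b_eq_three_roots (P := (⟨1, -e₁, e₂, -e₃⟩ : Cubic F)) one_ne_zero h
  have hc := Cubic.c_eq_three_roots (P := (⟨1, -e₁, e₂, -e₃⟩ : Cubic F)) one_ne_zero h
  have hd := Cubic.d_eq_three_roots (P := (⟨1, -e₁, e₂, -e₃⟩ : Cubic F)) one_ne_zero h
  simp only [map_one, map_neg] at hb hc hd
  refine ⟨r₁, r₂, r₃, by linear_combination -hb, by linear_combination hc,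
    by linear_combination -hd, ?_⟩
  rw [monicCubic_eq_toPoly, ← Cubic.map_toPoly]
  exact h

/-- A root of an irreducible cubic satisfies no nontrivial quadratic equation. -/
theorem eq_zero_of_isRoot (hf : ∀ r : F, (monicCubic e₁ e₂ e₃).eval r ≠ 0)
    {r : AlgebraicClosure F} (hr : aeval r (monicCubic e₁ e₂ e₃) = 0) {x y z : F}
    (h : algebraMap F (AlgebraicClosure F) x + r * algebraMap F _ y +
      r ^ 2 * algebraMap F _ z = 0) : x = 0 ∧ y = 0 ∧ z = 0 := by
  have hmin : minpoly F r = monicCubic e₁ e₂ e₃ :=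
    (minpoly.eq_of_irreducible_of_monic (monicCubic_irreducible hf) hr monicCubic_monic).symm
  have h0 : C z * X ^ 2 + C y * X + C x = 0 := by
    by_contra hne
    have hle := natDegree_le_natDegree (minpoly.degree_le_of_ne_zero F r hne (by
      simp only [map_add, map_mul, aeval_C, map_pow, aeval_X]
      linear_combination h))
    rw [hmin, monicCubic_natDegree] at hle
    have := natDegree_quadratic_le (a := z) (b := y) (c := x)
    omega
  refine ⟨?_, ?_, ?_⟩
  · simpa using congrArg (coeff · 0) h0
  · simpa [coeff_X, coeff_C] using congrArg (coeff · 1) h0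
  · simpa [coeff_X, coeff_C] using congrArg (coeff · 2) h0

/-- The norm form of an irreducible cubic is anisotropic. -/
theorem eq_zero_of_cubicNorm_eq_zero (hf : ∀ r : F, (monicCubic e₁ e₂ e₃).eval r ≠ 0) {x y z : F}
    (h : cubicNorm e₁ e₂ e₃ x y z = 0) : x = 0 ∧ y = 0 ∧ z = 0 := by
  obtain ⟨r₁, r₂, r₃, h₁, h₂, h₃, hr⟩ := exists_roots_monicCubic e₁ e₂ e₃
  have hroot : ∀ r ∈ ({r₁, r₂, r₃} : Multiset (AlgebraicClosure F)),
      aeval r (monicCubic e₁ e₂ e₃) = 0 := by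
    intro r hr'
    rw [← hr] at hr'
    simpa [aeval_def, eval_map] using (mem_roots'.1 hr').2
  have h' := congrArg (algebraMap F (AlgebraicClosure F)) h
  rw [map_cubicNorm, cubicNorm_eq_mul h₁ h₂ h₃, map_zero, mul_eq_zero, mul_eq_zero] at h'
  rcases h' with (h' | h') | h'
  · exact eq_zero_of_isRoot hf (hroot r₁ (by simp)) h'
  · exact eq_zero_of_isRoot hf (hroot r₂ (by simp)) h'
  · exact eq_zero_of_isRoot hf (hroot r₃ (by simp)) h'

/-- The part of `cubicNorm (x, y + w₁, z + w₂)` of degree two in `(w₁, w₂)`. -/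
def cubicNormQuadratic {R : Type*} [CommRing R] (e₁ e₂ e₃ x y z w₁ w₂ : R) : R :=
  (e₂ * x + 3 * e₃ * y + e₁ * e₃ * z) * w₁ ^ 2 +
    ((e₁ * e₂ - 3 * e₃) * x + 2 * e₁ * e₃ * y + 2 * e₂ * e₃ * z) * (w₁ * w₂) +
    ((e₂ ^ 2 - 2 * e₁ * e₃) * x + e₂ * e₃ * y + 3 * e₃ ^ 2 * z) * w₂ ^ 2

/-- For a separable irreducible cubic, the second order part of the norm form at a nonzero point
does not vanish identically in the directions `(0, w₁, w₂)`: the conditions are linear in the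
point, with determinant the discriminant times a power of the constant term. -/
theorem exists_cubicNormQuadratic_ne_zero (hf : ∀ r : F, (monicCubic e₁ e₂ e₃).eval r ≠ 0)
    (hs : (monicCubic e₁ e₂ e₃).Separable) {x y z : F} (hx : ¬ (x = 0 ∧ y = 0 ∧ z = 0)) :
    ∃ w₁ w₂ : F, cubicNormQuadratic e₁ e₂ e₃ x y z w₁ w₂ ≠ 0 := by
  by_contra! hQ
  obtain ⟨r₁, r₂, r₃, h₁, h₂, h₃, hr⟩ := exists_roots_monicCubic e₁ e₂ e₃
  have hnd := nodup_roots (hs.map (f := algebraMap F (AlgebraicClosure F)))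
  rw [hr] at hnd
  simp only [Multiset.insert_eq_cons, Multiset.nodup_cons, Multiset.mem_cons,
    Multiset.mem_singleton, Multiset.nodup_singleton, and_true, not_or] at hnd
  obtain ⟨⟨h12, h13⟩, h23⟩ := hnd
  have he₃ : e₃ ≠ 0 := by
    intro h
    exact hf 0 (by simp [eval_monicCubic, h])
  have hr3 : r₁ * r₂ * r₃ ≠ 0 := by
    rw [← h₃]
    simpa using he₃
  have q1 := congrArg (algebraMap F (AlgebraicClosure F)) (hQ 1 0)
  have q2 := congrArg (algebraMap F (AlgebraicClosure F)) (hQ 0 1)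
  have q3 := congrArg (algebraMap F (AlgebraicClosure F)) (hQ 1 1)
  simp only [cubicNormQuadratic, map_add, map_mul, map_sub, map_pow, map_one, map_zero, h₁, h₂,
    h₃, map_ofNat] at q1 q2 q3
  refine hx (eq_zero_of_cubicNorm_eq_zero hf ((algebraMap F (AlgebraicClosure F)).injective ?_))
  rw [map_cubicNorm, cubicNorm_eq_mul h₁ h₂ h₃, map_zero]
  -- The quadratic part at `(-r₃, 1)` is a multiple of one factor of the norm form.
  have : (r₁ * r₂) * ((r₁ - r₃) * (r₂ - r₃)) *
      (algebraMap F (AlgebraicClosure F) x + r₃ * algebraMap F _ y +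
        r₃ ^ 2 * algebraMap F _ z) = 0 := by
    linear_combination (r₃ ^ 2 + r₃) * q1 + (1 + r₃) * q2 - r₃ * q3
  have hne : (r₁ * r₂) * ((r₁ - r₃) * (r₂ - r₃)) ≠ 0 :=
    mul_ne_zero (left_ne_zero_of_mul hr3) (mul_ne_zero (sub_ne_zero.2 h13) (sub_ne_zero.2 h23))
  rw [(mul_eq_zero.1 this).resolve_left hne, mul_zero]

end Field

/-! ### Points over finite fields -/

theorem totalDegree_cubicEquation_le {F : Type*} [Field F] (e₁ e₂ e₃ a₁ a₂ d₁ d₂ : F) :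
    (MvPolynomial.X 3 *
      (MvPolynomial.C a₁ * MvPolynomial.X 0 + MvPolynomial.C d₁ * MvPolynomial.X 3) *
      (MvPolynomial.C a₂ * MvPolynomial.X 0 + MvPolynomial.C d₂ * MvPolynomial.X 3) -
      cubicNorm (MvPolynomial.C e₁) (MvPolynomial.C e₂) (MvPolynomial.C e₃) (MvPolynomial.X 0)
        (MvPolynomial.X 1) (MvPolynomial.X 2) : MvPolynomial (Fin 4) F).totalDegree ≤ 3 := by
  have hX : ∀ i : Fin 4, (MvPolynomial.X i : MvPolynomial (Fin 4) F).IsHomogeneous 1 :=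
    fun i => MvPolynomial.isHomogeneous_X F i
  have hL : ∀ (a d : F), (MvPolynomial.C a * MvPolynomial.X 0 + MvPolynomial.C d *
      MvPolynomial.X 3 : MvPolynomial (Fin 4) F).IsHomogeneous 1 :=
    fun a d => (MvPolynomial.isHomogeneous_C_mul_X a 0).add (MvPolynomial.isHomogeneous_C_mul_X d 3)
  have hm : ∀ (c : F) (i j k : Fin 4), (MvPolynomial.C c * (MvPolynomial.X i * MvPolynomial.X j *
      MvPolynomial.X k) : MvPolynomial (Fin 4) F).IsHomogeneous 3 := by
    intro c i j k
    simpa using (MvPolynomial.isHomogeneous_C (Fin 4) c).mul (((hX i).mul (hX j)).mul (hX k))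
  have hN : (cubicNorm (MvPolynomial.C e₁) (MvPolynomial.C e₂) (MvPolynomial.C e₃)
      (MvPolynomial.X 0) (MvPolynomial.X 1) (MvPolynomial.X 2) :
      MvPolynomial (Fin 4) F).IsHomogeneous 3 := by
    have := ((((((((((hm 1 0 0 0).add (hm e₁ 0 0 1)).add (hm (e₁ ^ 2 - 2 * e₂) 0 0 2)).add
      (hm e₂ 0 1 1)).add (hm (e₁ * e₂ - 3 * e₃) 0 1 2)).add
      (hm (e₂ ^ 2 - 2 * e₁ * e₃) 0 2 2)).add (hm e₃ 1 1 1)).add (hm (e₁ * e₃) 1 1 2)).add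
      (hm (e₂ * e₃) 1 2 2)).add (hm (e₃ ^ 2) 2 2 2))
    convert this using 1
    simp only [cubicNorm, map_sub, map_mul, map_pow, map_ofNat, map_one]
    ring
  have h := (((hX 3).mul (hL a₁ d₁)).mul (hL a₂ d₂)).sub hN
  exact h.totalDegree_le

/-- By Chevalley–Warning, the cubic surface has a point over `𝔽_q`; since the norm form is
anisotropic, that point has `T₃ ≠ 0`. -/
theorem exists_point_zmod {q : ℕ} [Fact q.Prime] {e₁ e₂ e₃ : ZMod q}
    (hf : ∀ r : ZMod q, (monicCubic e₁ e₂ e₃).eval r ≠ 0) (a₁ a₂ d₁ d₂ : ZMod q) :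
    ∃ x y z : ZMod q, cubicNorm e₁ e₂ e₃ x y z = (a₁ * x + d₁) * (a₂ * x + d₂) := by
  classical
  have hdvd := char_dvd_card_solutions q
    (f := (MvPolynomial.X 3 * (MvPolynomial.C a₁ * MvPolynomial.X 0 +
        MvPolynomial.C d₁ * MvPolynomial.X 3)
      * (MvPolynomial.C a₂ * MvPolynomial.X 0 + MvPolynomial.C d₂ * MvPolynomial.X 3) -
      cubicNorm (MvPolynomial.C e₁) (MvPolynomial.C e₂) (MvPolynomial.C e₃) (MvPolynomial.X 0)
        (MvPolynomial.X 1) (MvPolynomial.X 2) : MvPolynomial (Fin 4) (ZMod q)))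
    ((totalDegree_cubicEquation_le e₁ e₂ e₃ a₁ a₂ d₁ d₂).trans_lt (by simp))
  have heval : ∀ t : Fin 4 → ZMod q, MvPolynomial.eval t (MvPolynomial.X 3 *
      (MvPolynomial.C a₁ * MvPolynomial.X 0 + MvPolynomial.C d₁ * MvPolynomial.X 3)
      * (MvPolynomial.C a₂ * MvPolynomial.X 0 + MvPolynomial.C d₂ * MvPolynomial.X 3) -
      cubicNorm (MvPolynomial.C e₁) (MvPolynomial.C e₂) (MvPolynomial.C e₃) (MvPolynomial.X 0)
        (MvPolynomial.X 1) (MvPolynomial.X 2) : MvPolynomial (Fin 4) (ZMod q)) =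
      t 3 * (a₁ * t 0 + d₁ * t 3) * (a₂ * t 0 + d₂ * t 3) -
        cubicNorm e₁ e₂ e₃ (t 0) (t 1) (t 2) := by
    intro t
    simp [map_cubicNorm]
  simp only [heval] at hdvd
  have hcard := Nat.le_of_dvd (Fintype.card_pos_iff.2 ⟨⟨0, by simp [cubicNorm]⟩⟩) hdvd
  obtain ⟨⟨t, ht⟩, hne⟩ := Fintype.exists_ne_of_one_lt_card
    ((Fact.out : q.Prime).one_lt.trans_le hcard) ⟨0, by simp [cubicNorm]⟩
  have ht3 : t 3 ≠ 0 := by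
    intro h3
    rw [h3, zero_mul, zero_mul, zero_sub, neg_eq_zero] at ht
    obtain ⟨h0, h1, h2⟩ := eq_zero_of_cubicNorm_eq_zero hf ht
    refine hne (Subtype.ext (funext fun i => ?_))
    fin_cases i <;> simpa
  refine ⟨t 0 / t 3, t 1 / t 3, t 2 / t 3, ?_⟩
  have hscale : cubicNorm e₁ e₂ e₃ (t 0 / t 3) (t 1 / t 3) (t 2 / t 3) =
      cubicNorm e₁ e₂ e₃ (t 0) (t 1) (t 2) / t 3 ^ 3 := by
    simp only [cubicNorm]
    field_simp
  rw [hscale, ← sub_eq_zero.1 ht]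
  field_simp

/-- A point over `𝔽_q` at which one of the derivatives of the norm form in the second and third
coordinate does not vanish. If both vanish at some point, a line through it in the plane
`T₀ = const` with nonzero second order term meets the surface in exactly one further point, and
transversally there. -/
theorem exists_smooth_point_zmod {q : ℕ} [Fact q.Prime] {e₁ e₂ e₃ : ZMod q}
    (hf : ∀ r : ZMod q, (monicCubic e₁ e₂ e₃).eval r ≠ 0) (a₁ a₂ : ZMod q) {d₁ d₂ : ZMod q}
    (hd : d₁ * d₂ ≠ 0) :
    ∃ x y z : ZMod q, cubicNorm e₁ e₂ e₃ x y z = (a₁ * x + d₁) * (a₂ * x + d₂) ∧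
      (cubicNormDerivY e₁ e₂ e₃ x y z ≠ 0 ∨ cubicNormDerivZ e₁ e₂ e₃ x y z ≠ 0) := by
  obtain ⟨x, y, z, h⟩ := exists_point_zmod hf a₁ a₂ d₁ d₂
  by_cases hD : cubicNormDerivY e₁ e₂ e₃ x y z ≠ 0 ∨ cubicNormDerivZ e₁ e₂ e₃ x y z ≠ 0
  · exact ⟨x, y, z, h, hD⟩
  push Not at hD
  obtain ⟨hY, hZ⟩ := hD
  have hs : (monicCubic e₁ e₂ e₃).Separable :=
    PerfectField.separable_of_irreducible (monicCubic_irreducible hf)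
  have hne : ¬ (x = 0 ∧ y = 0 ∧ z = 0) := by
    rintro ⟨rfl, rfl, rfl⟩
    apply hd
    simpa [cubicNorm] using h.symm
  obtain ⟨w₁, w₂, hQ⟩ := exists_cubicNormQuadratic_ne_zero hf hs hne
  have hN : cubicNorm e₁ e₂ e₃ 0 w₁ w₂ ≠ 0 := by
    intro h0
    obtain ⟨-, rfl, rfl⟩ := eq_zero_of_cubicNorm_eq_zero hf h0
    simp [cubicNormQuadratic] at hQ
  obtain ⟨μ, hμ⟩ : ∃ μ, μ * cubicNorm e₁ e₂ e₃ 0 w₁ w₂ =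
      -cubicNormQuadratic e₁ e₂ e₃ x y z w₁ w₂ := ⟨_, div_mul_cancel₀ _ hN⟩
  have hμ0 : μ ≠ 0 := by
    rintro rfl
    exact hQ (by simpa using hμ)
  refine ⟨x, y + μ * w₁, z + μ * w₂, ?_, ?_⟩
  · rw [← h]
    have : cubicNorm e₁ e₂ e₃ x (y + μ * w₁) (z + μ * w₂) = cubicNorm e₁ e₂ e₃ x y z +
        μ * (w₁ * cubicNormDerivY e₁ e₂ e₃ x y z + w₂ * cubicNormDerivZ e₁ e₂ e₃ x y z) +
        μ ^ 2 * (cubicNormQuadratic e₁ e₂ e₃ x y z w₁ w₂ +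
          μ * cubicNorm e₁ e₂ e₃ 0 w₁ w₂) := by
      simp only [cubicNorm, cubicNormDerivY, cubicNormDerivZ, cubicNormQuadratic]
      ring
    rw [this, hY, hZ, hμ]
    ring
  · by_contra! hD
    obtain ⟨hY', hZ'⟩ := hD
    have : w₁ * cubicNormDerivY e₁ e₂ e₃ x (y + μ * w₁) (z + μ * w₂) +
        w₂ * cubicNormDerivZ e₁ e₂ e₃ x (y + μ * w₁) (z + μ * w₂) =
        (w₁ * cubicNormDerivY e₁ e₂ e₃ x y z + w₂ * cubicNormDerivZ e₁ e₂ e₃ x y z) +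
        2 * μ * cubicNormQuadratic e₁ e₂ e₃ x y z w₁ w₂ +
        3 * μ * (μ * cubicNorm e₁ e₂ e₃ 0 w₁ w₂) := by
      simp only [cubicNorm, cubicNormDerivY, cubicNormDerivZ, cubicNormQuadratic]
      ring
    rw [hY, hZ, hY', hZ', hμ] at this
    exact mul_ne_zero hμ0 hQ (by linear_combination this)

/-! ### Points over the `q`-adic integers: Hensel's lemma -/

theorem exists_padicInt_root {q : ℕ} [Fact q.Prime] (P : ℤ[X]) (a : ℤ)
    (h0 : ((P.eval a : ℤ) : ZMod q) = 0) (h1 : ((P.derivative.eval a : ℤ) : ZMod q) ≠ 0) :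
    ∃ z : ℤ_[q], aeval z P = 0 := by
  have hcast : ∀ Q : ℤ[X], aeval (a : ℤ_[q]) Q = ((Q.eval a : ℤ) : ℤ_[q]) := fun Q => by
    rw [← eq_intCast (algebraMap ℤ ℤ_[q]) a, aeval_algebraMap_apply, eq_intCast, coe_aeval_eq_eval]
  have hlt : ‖aeval (a : ℤ_[q]) P‖ < 1 := by
    rw [hcast, PadicInt.norm_int_lt_one_iff_dvd, ← ZMod.intCast_zmod_eq_zero_iff_dvd]
    exact h0
  have heq : ‖aeval (a : ℤ_[q]) P.derivative‖ = 1 := by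
    refine le_antisymm (PadicInt.norm_le_one _) (not_lt.1 fun hlt' => h1 ?_)
    rw [hcast, PadicInt.norm_int_lt_one_iff_dvd] at hlt'
    exact (ZMod.intCast_zmod_eq_zero_iff_dvd _ _).2 hlt'
  obtain ⟨z, hz, -⟩ := hensels_lemma (F := P) (a := (a : ℤ_[q])) (by rw [heq]; simpa using hlt)
  exact ⟨z, hz⟩

/-- The value of the cubic form of the surface at the point `(x : y : z : w)`. -/
def surfaceValue {R : Type*} [CommRing R] (e₁ e₂ e₃ a₁ a₂ d₁ d₂ : ℤ) (x y z w : R) : R :=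
  w * (a₁ * x + d₁ * w) * (a₂ * x + d₂ * w) -
    cubicNorm (e₁ : R) (e₂ : R) (e₃ : R) x y z

theorem map_surfaceValue {R S : Type*} [CommRing R] [CommRing S] (φ : R →+* S)
    (e₁ e₂ e₃ a₁ a₂ d₁ d₂ : ℤ) (x y z w : R) :
    φ (surfaceValue e₁ e₂ e₃ a₁ a₂ d₁ d₂ x y z w) =
      surfaceValue e₁ e₂ e₃ a₁ a₂ d₁ d₂ (φ x) (φ y) (φ z) (φ w) := by
  simp [surfaceValue, map_cubicNorm]

/-- The surface has a point over `R` with homogeneous coordinates generating the unit ideal. -/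
def HasPoint (R : Type*) [CommRing R] (e₁ e₂ e₃ a₁ a₂ d₁ d₂ : ℤ) : Prop :=
  ∃ t c : Fin 4 → R, ∑ i, c i * t i = 1 ∧
    surfaceValue e₁ e₂ e₃ a₁ a₂ d₁ d₂ (t 0) (t 1) (t 2) (t 3) = 0

theorem hasPoint_of_coordinate_eq_one {R : Type*} [CommRing R] {e₁ e₂ e₃ a₁ a₂ d₁ d₂ : ℤ}
    (t : Fin 4 → R) (i : Fin 4) (hi : t i = 1)
    (h : surfaceValue e₁ e₂ e₃ a₁ a₂ d₁ d₂ (t 0) (t 1) (t 2) (t 3) = 0) :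
    HasPoint R e₁ e₂ e₃ a₁ a₂ d₁ d₂ :=
  ⟨t, Pi.single i 1, by simp [Pi.single_apply, hi], h⟩

/-- A zero of `T (a₁ + d₁ T) (a₂ + d₂ T) - 1` gives a point on the line `T₁ = T₂ = 0`. -/
theorem hasPoint_of_isRoot {R : Type*} [CommRing R] {e₁ e₂ e₃ a₁ a₂ d₁ d₂ : ℤ} {s : R}
    (hs : (rootPoly R a₁ a₂ d₁ d₂).eval s = 0) : HasPoint R e₁ e₂ e₃ a₁ a₂ d₁ d₂ := by
  refine hasPoint_of_coordinate_eq_one ![1, 0, 0, s] 0 rfl ?_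
  simp [rootPoly] at hs
  simp [surfaceValue, cubicNorm]
  linear_combination hs

theorem HasPoint.map {R S : Type*} [CommRing R] [CommRing S] (φ : R →+* S)
    {e₁ e₂ e₃ a₁ a₂ d₁ d₂ : ℤ} (h : HasPoint R e₁ e₂ e₃ a₁ a₂ d₁ d₂) :
    HasPoint S e₁ e₂ e₃ a₁ a₂ d₁ d₂ := by
  obtain ⟨t, c, h1, h2⟩ := h
  refine ⟨fun i => φ (t i), fun i => φ (c i), ?_, ?_⟩
  · rw [← map_one φ, ← h1]
    simp
  · rw [← map_surfaceValue, h2, map_zero]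

theorem HasPoint.pi {ι : Type*} {R : ι → Type*} [∀ v, CommRing (R v)]
    {e₁ e₂ e₃ a₁ a₂ d₁ d₂ : ℤ} (h : ∀ v, HasPoint (R v) e₁ e₂ e₃ a₁ a₂ d₁ d₂) :
    HasPoint (∀ v, R v) e₁ e₂ e₃ a₁ a₂ d₁ d₂ := by
  choose t c h1 h2 using h
  refine ⟨fun i v => t v i, fun i v => c v i, ?_, ?_⟩
  · funext v
    simpa using h1 v
  · funext v
    have := map_surfaceValue (Pi.evalRingHom R v) e₁ e₂ e₃ a₁ a₂ d₁ d₂ (fun v => t v 0)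
      (fun v => t v 1) (fun v => t v 2) (fun v => t v 3)
    exact this.trans (h2 v)

theorem HasPoint.prod {R S : Type*} [CommRing R] [CommRing S] {e₁ e₂ e₃ a₁ a₂ d₁ d₂ : ℤ}
    (hR : HasPoint R e₁ e₂ e₃ a₁ a₂ d₁ d₂) (hS : HasPoint S e₁ e₂ e₃ a₁ a₂ d₁ d₂) :
    HasPoint (R × S) e₁ e₂ e₃ a₁ a₂ d₁ d₂ := by
  obtain ⟨t, c, h1, h2⟩ := hR
  obtain ⟨t', c', h1', h2'⟩ := hS
  refine ⟨fun i => (t i, t' i), fun i => (c i, c' i), ?_, ?_⟩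
  · ext
    · simpa [Prod.fst_sum] using h1
    · simpa [Prod.snd_sum] using h1'
  · ext
    · exact (map_surfaceValue (RingHom.fst R S) e₁ e₂ e₃ a₁ a₂ d₁ d₂ _ _ _ _).trans h2
    · exact (map_surfaceValue (RingHom.snd R S) e₁ e₂ e₃ a₁ a₂ d₁ d₂ _ _ _ _).trans h2'

section

variable {q : ℕ} [Fact q.Prime] {e₁ e₂ e₃ a₁ a₂ d₁ d₂ : ℤ}

/-- A simple zero modulo `q` of `T (a₁ + d₁ T) (a₂ + d₂ T) - 1` lifts to a point on the line
`T₁ = T₂ = 0`. -/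
theorem hasPoint_padicInt_of_simple_root {s : ZMod q}
    (h0 : (rootPoly (ZMod q) a₁ a₂ d₁ d₂).eval s = 0)
    (h1 : (rootPoly (ZMod q) a₁ a₂ d₁ d₂).derivative.eval s ≠ 0) :
    HasPoint ℤ_[q] e₁ e₂ e₃ a₁ a₂ d₁ d₂ := by
  obtain ⟨s, rfl⟩ := ZMod.intCast_surjective s
  have hmap : (rootPoly ℤ a₁ a₂ d₁ d₂).map (Int.castRingHom (ZMod q)) =
      rootPoly (ZMod q) a₁ a₂ d₁ d₂ := by simp [rootPoly]
  rw [← hmap] at h0 h1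
  rw [derivative_map] at h1
  obtain ⟨z, hz⟩ := exists_padicInt_root (q := q) (rootPoly ℤ a₁ a₂ d₁ d₂) s
    (by simpa using h0) (by simpa using h1)
  refine hasPoint_of_isRoot (s := z) ?_
  simpa [rootPoly] using hz

/-- A `q`-adic root `r` of the cubic gives a point on the line `T₃ = 0`, `T₀ + r T₁ + r² T₂ = 0`. -/
theorem hasPoint_padicInt_of_root {r : ℤ_[q]}
    (hr : (monicCubic (e₁ : ℤ_[q]) e₂ e₃).eval r = 0) :
    HasPoint ℤ_[q] e₁ e₂ e₃ a₁ a₂ d₁ d₂ := by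
  refine hasPoint_of_coordinate_eq_one ![-r, 1, 0, 0] 1 rfl ?_
  rw [eval_monicCubic] at hr
  simp [surfaceValue, cubicNorm]
  linear_combination hr

theorem hasPoint_padicInt_swap (h : HasPoint ℤ_[q] e₁ e₂ e₃ a₂ a₁ d₂ d₁) :
    HasPoint ℤ_[q] e₁ e₂ e₃ a₁ a₂ d₁ d₂ := by
  obtain ⟨t, c, h1, h2⟩ := h
  refine ⟨t, c, h1, ?_⟩
  rw [← h2, surfaceValue, surfaceValue]
  ring

/-- If `q` divides `d₁` only, then `(0 : 0 : 0 : 1)` is a smooth point modulo `q`. -/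
theorem hasPoint_padicInt_of_dvd_left (hd₁ : (d₁ : ZMod q) = 0) (ha₁ : (a₁ : ZMod q) ≠ 0)
    (hd₂ : (d₂ : ZMod q) ≠ 0) : HasPoint ℤ_[q] e₁ e₂ e₃ a₁ a₂ d₁ d₂ := by
  obtain ⟨z, hz⟩ := exists_padicInt_root (q := q)
    ((C a₁ * X + C d₁) * (C a₂ * X + C d₂) - X ^ 3) 0 (by simp [hd₁])
    (by simpa [hd₁] using ⟨ha₁, hd₂⟩)
  refine hasPoint_of_coordinate_eq_one ![z, 0, 0, 1] 3 rfl ?_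
  simp at hz
  simp [surfaceValue, cubicNorm]
  linear_combination hz

/-- The local solubility at a prime `q` modulo which the cubic is irreducible. -/
theorem hasPoint_padicInt_of_irreducible
    (hf : ∀ r : ZMod q, (monicCubic (e₁ : ZMod q) e₂ e₃).eval r ≠ 0)
    (h₁ : ¬ ((a₁ : ZMod q) = 0 ∧ (d₁ : ZMod q) = 0))
    (h₂ : ¬ ((a₂ : ZMod q) = 0 ∧ (d₂ : ZMod q) = 0)) :
    HasPoint ℤ_[q] e₁ e₂ e₃ a₁ a₂ d₁ d₂ := by
  by_cases hd₁ : (d₁ : ZMod q) = 0 <;> by_cases hd₂ : (d₂ : ZMod q) = 0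
  · have ha₁ : (a₁ : ZMod q) ≠ 0 := fun h => h₁ ⟨h, hd₁⟩
    have ha₂ : (a₂ : ZMod q) ≠ 0 := fun h => h₂ ⟨h, hd₂⟩
    refine hasPoint_padicInt_of_simple_root (s := (a₁ * a₂ : ZMod q)⁻¹) ?_ ?_
    · simp [rootPoly, hd₁, hd₂]
      field_simp
      simp
    · simp [rootPoly, hd₁, hd₂, ha₁, ha₂]
  · exact hasPoint_padicInt_of_dvd_left hd₁ (fun h => h₁ ⟨h, hd₁⟩) hd₂
  · exact hasPoint_padicInt_swap (hasPoint_padicInt_of_dvd_left hd₂ (fun h => h₂ ⟨h, hd₂⟩) hd₁)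
  · obtain ⟨x, y, z, h, hD⟩ := exists_smooth_point_zmod hf (a₁ : ZMod q) a₂ (mul_ne_zero hd₁ hd₂)
    obtain ⟨x, rfl⟩ := ZMod.intCast_surjective x
    obtain ⟨y, rfl⟩ := ZMod.intCast_surjective y
    obtain ⟨z, rfl⟩ := ZMod.intCast_surjective z
    rcases hD with hD | hD
    · obtain ⟨t, ht⟩ := exists_padicInt_root (q := q)
        (cubicNorm (C e₁) (C e₂) (C e₃) (C x) X (C z) - C ((a₁ * x + d₁) * (a₂ * x + d₂))) y
        (by
          rw [← sub_eq_zero] at h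
          rw [← h]
          simp [cubicNorm])
        (by
          convert hD using 1
          simp [cubicNorm, cubicNormDerivY, derivative_pow]
          ring)
      refine hasPoint_of_coordinate_eq_one ![(x : ℤ_[q]), t, z, 1] 3 rfl ?_
      have := map_cubicNorm (aeval t : ℤ[X] →ₐ[ℤ] ℤ_[q]).toRingHom (C e₁) (C e₂) (C e₃) (C x) X
        (C z)
      simp at ht this
      rw [this] at ht
      simp [surfaceValue]
      linear_combination -ht
    · obtain ⟨t, ht⟩ := exists_padicInt_root (q := q)
        (cubicNorm (C e₁) (C e₂) (C e₃) (C x) (C y) X - C ((a₁ * x + d₁) * (a₂ * x + d₂))) z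
        (by
          rw [← sub_eq_zero] at h
          rw [← h]
          simp [cubicNorm])
        (by
          convert hD using 1
          simp [cubicNorm, cubicNormDerivZ, derivative_pow]
          ring)
      refine hasPoint_of_coordinate_eq_one ![(x : ℤ_[q]), y, t, 1] 3 rfl ?_
      have := map_cubicNorm (aeval t : ℤ[X] →ₐ[ℤ] ℤ_[q]).toRingHom (C e₁) (C e₂) (C e₃) (C x) (C y)
        X
      simp at ht this
      rw [this] at ht
      simp [surfaceValue]
      linear_combination -ht

end

/-! ### From local points to an adelic point -/

/-- Families of real and of `q`-adic integral elements form a subring of the adeles. -/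
noncomputable def integralAdeles :
    ((v : NumberField.InfinitePlace ℚ) → v.Completion) ×
      ((v : IsDedekindDomain.HeightOneSpectrum ℤ) → v.adicCompletionIntegers ℚ) →+*
      NumberField.AdeleRing ℤ ℚ where
  toFun x := (x.1, (⟨fun v => (x.2 v : v.adicCompletion ℚ),
    Filter.Eventually.of_forall fun v => (x.2 v).2⟩ : IsDedekindDomain.FiniteAdeleRing ℤ ℚ))
  map_one' := rfl
  map_zero' := rfl
  map_mul' _ _ := rfl
  map_add' _ _ := rfl

theorem exists_isRoot_of_odd_natDegree {f : ℝ[X]} (hf : Odd f.natDegree)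
    (hlc : 0 < f.leadingCoeff) : ∃ x, f.eval x = 0 := by
  have hdeg : 0 < f.degree := natDegree_pos_iff_degree_pos.1 hf.pos
  have htop : Filter.Tendsto (fun x => f.eval x) Filter.atTop Filter.atTop :=
    f.tendsto_atTop_of_leadingCoeff_nonneg hdeg hlc.le
  have hbot : Filter.Tendsto (fun x => f.eval x) Filter.atBot Filter.atBot := by
    have hneg : Filter.Tendsto (fun x => (-f.comp (-X)).eval x) Filter.atTop Filter.atTop := by
      refine Polynomial.tendsto_atTop_of_leadingCoeff_nonneg _ ?_ ?_
      · rw [degree_neg, ← natDegree_pos_iff_degree_pos, natDegree_comp]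
        simpa using hf.pos
      · rw [leadingCoeff_neg, leadingCoeff_comp (by simp), leadingCoeff_neg, leadingCoeff_X,
          hf.neg_one_pow]
        simpa using hlc.le
    have := Filter.tendsto_neg_atTop_atBot.comp (hneg.comp Filter.tendsto_neg_atBot_atTop)
    refine this.congr fun x => ?_
    simp
  exact f.continuous.surjective htop hbot 0

theorem rootPoly_eq_toPoly (R : Type*) [CommRing R] (a₁ a₂ d₁ d₂ : ℤ) :
    rootPoly R a₁ a₂ d₁ d₂ =
      Cubic.toPoly ⟨(d₁ * d₂ : R), a₁ * d₂ + a₂ * d₁, a₁ * a₂, -1⟩ := by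
  simp [rootPoly, Cubic.toPoly]
  ring

theorem exists_real_isRoot {a₁ a₂ d₁ d₂ : ℤ} (hd : d₁ * d₂ ≠ 0) :
    ∃ s : ℝ, (rootPoly ℝ a₁ a₂ d₁ d₂).eval s = 0 := by
  have hd' : (d₁ * d₂ : ℝ) ≠ 0 := by exact_mod_cast hd
  have hdeg := Cubic.natDegree_of_a_ne_zero (P := ⟨(d₁ * d₂ : ℝ), a₁ * d₂ + a₂ * d₁, a₁ * a₂, -1⟩)
    hd'
  have hlc := Cubic.leadingCoeff_of_a_ne_zero
    (P := ⟨(d₁ * d₂ : ℝ), a₁ * d₂ + a₂ * d₁, a₁ * a₂, -1⟩) hd'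
  rw [← rootPoly_eq_toPoly] at hdeg hlc
  rcases lt_or_gt_of_ne hd' with h | h
  · obtain ⟨s, hs⟩ := exists_isRoot_of_odd_natDegree (f := -rootPoly ℝ a₁ a₂ d₁ d₂)
      (by rw [natDegree_neg, hdeg]; decide) (by rw [leadingCoeff_neg, hlc]; exact neg_pos.2 h)
    exact ⟨s, by simpa using hs⟩
  · exact exists_isRoot_of_odd_natDegree (by rw [hdeg]; decide) (hlc.symm ▸ h)

/-- The completion of `ℚ` at a maximal ideal of `ℤ` contains the corresponding `ℤ_[q]`; `ℤ` is
replaced by an isomorphic ring `R` here, since the two `ℤ`-algebra structures on the completion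
would be confused otherwise. -/
theorem nonempty_padicInt_ringHom (R : Type*) [CommRing R] [Algebra R ℚ] [IsIntegralClosure R ℤ ℚ]
    [IsDedekindDomain R] [IsFractionRing R ℚ] (v : IsDedekindDomain.HeightOneSpectrum R)
    [Fact (Rat.HeightOneSpectrum.primesEquiv v : ℕ).Prime] :
    Nonempty (ℤ_[(Rat.HeightOneSpectrum.primesEquiv v : ℕ)] →+* v.adicCompletionIntegers ℚ) :=
  ⟨((RingEquivClass.toRingEquiv
    (Rat.HeightOneSpectrum.adicCompletionIntegers.padicIntEquiv v)).symm : _ →+* _)⟩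

/-- Local solubility everywhere gives an adelic point. -/
theorem hasPoint_adeleRing {e₁ e₂ e₃ a₁ a₂ d₁ d₂ : ℤ} (hd : d₁ * d₂ ≠ 0)
    (h : ∀ (q : ℕ) [Fact q.Prime], HasPoint ℤ_[q] e₁ e₂ e₃ a₁ a₂ d₁ d₂) :
    HasPoint (NumberField.AdeleRing ℤ ℚ) e₁ e₂ e₃ a₁ a₂ d₁ d₂ := by
  refine ((HasPoint.pi fun v => ?_).prod (HasPoint.pi fun v => ?_)).map integralAdeles
  · obtain ⟨s, hs⟩ := exists_real_isRoot (a₁ := a₁) (a₂ := a₂) hd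
    have hv : v.IsReal := by
      rw [Subsingleton.elim v Rat.infinitePlace]
      exact Rat.isReal_infinitePlace
    exact (hasPoint_of_isRoot hs).map
      (NumberField.InfinitePlace.Completion.ringEquivRealOfIsReal hv).symm.toRingHom
  · have : Fact (Rat.HeightOneSpectrum.primesEquiv v : ℕ).Prime :=
      ⟨(Rat.HeightOneSpectrum.primesEquiv v).2⟩
    obtain ⟨φ⟩ := nonempty_padicInt_ringHom ℤ v
    exact (h (Rat.HeightOneSpectrum.primesEquiv v)).map φ

/-! ### Primitive integral points -/

theorem exists_primitive_coordinates {ι : Type*} [Fintype ι] {t : ι → ℚ} (ht : t ≠ 0) :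
    ∃ (c : ℚ) (u : ι → ℤ), c ≠ 0 ∧ (∀ i, t i = c * u i) ∧
      ∀ q : ℕ, q.Prime → ∃ i, ¬ (q : ℤ) ∣ u i := by
  classical
  obtain ⟨b, hb⟩ := IsLocalization.exist_integer_multiples_of_finset (nonZeroDivisors ℤ)
    (Finset.univ.image t)
  have hb0 : ((b : ℤ) : ℚ) ≠ 0 := by exact_mod_cast nonZeroDivisors.coe_ne_zero b
  have hb' : ∀ i, ∃ n : ℤ, (n : ℚ) = (b : ℤ) * t i := by
    intro i
    obtain ⟨n, hn⟩ := hb (t i) (Finset.mem_image_of_mem _ (Finset.mem_univ i))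
    exact ⟨n, by simpa using hn⟩
  choose n hn using hb'
  obtain ⟨j, hj⟩ := Function.ne_iff.1 ht
  obtain ⟨u, hu, hgcd⟩ := Finset.extract_gcd n ⟨j, Finset.mem_univ j⟩
  have hg : (Finset.univ.gcd n : ℤ) ≠ 0 := by
    intro h0
    have h1 := hu j (Finset.mem_univ j)
    rw [h0, zero_mul] at h1
    have h2 := hn j
    rw [h1, Int.cast_zero] at h2
    exact mul_ne_zero hb0 hj h2.symm
  refine ⟨(Finset.univ.gcd n : ℤ) / (b : ℤ), u, div_ne_zero (by exact_mod_cast hg) hb0, ?_, ?_⟩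
  · intro i
    have h1 : ((n i : ℤ) : ℚ) = (Finset.univ.gcd n : ℤ) * u i := by
      exact_mod_cast hu i (Finset.mem_univ i)
    field_simp
    rw [← h1, hn i, mul_comm]
  · intro q hq
    by_contra! h
    have hd : (q : ℤ) ∣ Finset.univ.gcd u := Finset.dvd_gcd fun i _ => h i
    rw [hgcd] at hd
    exact (Nat.prime_iff_prime_int.1 hq).not_dvd_one hd

/-- For a cubic which is Eisenstein at `p`, the surface has no primitive integral point with
`p ∣ T₀`: the three terms of the norm form have distinct valuations modulo `3`. -/
theorem not_dvd_of_eisenstein {p : ℤ} (hp : Prime p) {e₁ e₂ e₃ a₁ a₂ d₁ d₂ x y z w : ℤ}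
    (h₁ : p ∣ e₁) (h₂ : p ∣ e₂) (h₃ : p ∣ e₃) (h₃' : ¬ p ^ 2 ∣ e₃) (hd : ¬ p ∣ d₁ * d₂)
    (h : surfaceValue e₁ e₂ e₃ a₁ a₂ d₁ d₂ x y z w = 0)
    (hprim : ¬ (p ∣ x ∧ p ∣ y ∧ p ∣ z ∧ p ∣ w)) : ¬ p ∣ x := by
  intro hx
  obtain ⟨f₁, rfl⟩ := h₁
  obtain ⟨f₂, rfl⟩ := h₂
  obtain ⟨f₃, rfl⟩ := h₃
  have hf₃ : ¬ p ∣ f₃ := fun hf => h₃' (by rw [sq]; exact mul_dvd_mul_left p hf)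
  have hp0 := hp.ne_zero
  obtain ⟨x, rfl⟩ := hx
  simp only [surfaceValue, Int.cast_id, cubicNorm] at h
  have hw : p ∣ w := by
    refine hp.dvd_of_dvd_pow ((hp.dvd_or_dvd (a := d₁ * d₂) (b := w ^ 3) ⟨y ^ 3 * f₃ -
      3 * p * x * y * z * f₃ + p * x * y ^ 2 * f₂ + p * f₁ * f₃ * y ^ 2 * z +
      p * f₂ * f₃ * y * z ^ 2 + p * f₃ ^ 2 * z ^ 3 + p ^ 2 * x * f₁ * f₂ * y * z -
      2 * p ^ 2 * x * f₁ * f₃ * z ^ 2 + p ^ 2 * x * f₂ ^ 2 * z ^ 2 + p ^ 2 * x ^ 2 * f₁ * y -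
      2 * p ^ 2 * x ^ 2 * f₂ * z + p ^ 2 * x ^ 3 + p ^ 3 * x ^ 2 * f₁ ^ 2 * z -
      x * w ^ 2 * (a₁ * d₂ + a₂ * d₁) - p * x ^ 2 * w * a₁ * a₂, ?_⟩).resolve_left hd)
    linear_combination h
  obtain ⟨w, rfl⟩ := hw
  have hy : p ∣ y := by
    refine hp.dvd_of_dvd_pow ((hp.dvd_or_dvd (a := f₃) (b := y ^ 3)
      ⟨p * (w * (a₁ * x + d₁ * w) * (a₂ * x + d₂ * w)) - (-
      3 * x * y * z * f₃ + x * y ^ 2 * f₂ + f₁ * f₃ * y ^ 2 * z +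
      f₂ * f₃ * y * z ^ 2 + f₃ ^ 2 * z ^ 3 + p * x * f₁ * f₂ * y * z -
      2 * p * x * f₁ * f₃ * z ^ 2 + p * x * f₂ ^ 2 * z ^ 2 + p * x ^ 2 * f₁ * y -
      2 * p * x ^ 2 * f₂ * z + p * x ^ 3 + p ^ 2 * x ^ 2 * f₁ ^ 2 * z),
      mul_left_cancel₀ hp0 ?_⟩).resolve_left hf₃)
    linear_combination -h
  obtain ⟨y, rfl⟩ := hy
  have hz : p ∣ z := by
    refine hp.dvd_of_dvd_pow ((hp.dvd_or_dvd (a := f₃ ^ 2) (b := z ^ 3)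
      ⟨w * (a₁ * x + d₁ * w) * (a₂ * x + d₂ * w) - (p * y ^ 3 * f₃ -
      3 * x * y * z * f₃ + p * x * y ^ 2 * f₂ + p * f₁ * f₃ * y ^ 2 * z +
      f₂ * f₃ * y * z ^ 2 + p * x * f₁ * f₂ * y * z -
      2 * x * f₁ * f₃ * z ^ 2 + x * f₂ ^ 2 * z ^ 2 + p * x ^ 2 * f₁ * y -
      2 * x ^ 2 * f₂ * z + x ^ 3 + p * x ^ 2 * f₁ ^ 2 * z),
      mul_left_cancel₀ (pow_ne_zero 2 hp0) ?_⟩).resolve_left fun hf => hf₃ (hp.dvd_of_dvd_pow hf))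
    linear_combination -h
  exact hprim ⟨dvd_mul_right p x, dvd_mul_right p y, hz, dvd_mul_right p w⟩

theorem padicValInt_pow {q : ℕ} [Fact q.Prime] (a : ℤ) (n : ℕ) :
    padicValInt q (a ^ n) = n * padicValInt q a := by
  rw [padicValInt, padicValInt, Int.natAbs_pow, padicValNat.pow]

/-- Modulo `q` the norm form is anisotropic, so that its values have valuation divisible by `3`. -/
theorem three_dvd_padicValInt_cubicNorm {q : ℕ} [Fact q.Prime] {e₁ e₂ e₃ : ℤ}
    (hf : ∀ r : ZMod q, (monicCubic (e₁ : ZMod q) e₂ e₃).eval r ≠ 0) :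
    ∀ (n : ℕ) (x y z : ℤ), padicValInt q (cubicNorm e₁ e₂ e₃ x y z) = n → 3 ∣ n := by
  intro n
  induction n using Nat.strong_induction_on with
  | _ n ih =>
    intro x y z hn
    rcases Nat.eq_zero_or_pos n with rfl | hpos
    · exact dvd_zero 3
    have hq : (q : ℤ) ≠ 0 := by exact_mod_cast (Fact.out : q.Prime).ne_zero
    have hne : cubicNorm e₁ e₂ e₃ x y z ≠ 0 := by
      intro h0
      rw [h0, padicValInt.zero] at hn
      omega
    have hdvd : ((cubicNorm e₁ e₂ e₃ x y z : ℤ) : ZMod q) = 0 := by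
      rw [ZMod.intCast_zmod_eq_zero_iff_dvd]
      by_contra hnd
      rw [padicValInt.eq_zero_of_not_dvd hnd] at hn
      omega
    rw [← eq_intCast (Int.castRingHom (ZMod q)), map_cubicNorm] at hdvd
    obtain ⟨hx, hy, hz⟩ := eq_zero_of_cubicNorm_eq_zero hf hdvd
    rw [eq_intCast, ZMod.intCast_zmod_eq_zero_iff_dvd] at hx hy hz
    obtain ⟨x, rfl⟩ := hx
    obtain ⟨y, rfl⟩ := hy
    obtain ⟨z, rfl⟩ := hz
    have hscale : cubicNorm e₁ e₂ e₃ (q * x) (q * y) (q * z) =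
        (q : ℤ) ^ 3 * cubicNorm e₁ e₂ e₃ x y z := by
      simp only [cubicNorm]
      ring
    rw [hscale] at hn hne
    rw [padicValInt.mul (pow_ne_zero 3 hq) (right_ne_zero_of_mul hne), padicValInt_pow,
      padicValInt_self] at hn
    have := ih _ (by omega) x y z rfl
    omega

/-- If the prime divisors of an integer which are not cubes modulo `p` all have multiplicity
divisible by `3`, then the integer is a cube modulo `p`; here `e = (p - 1) / 3`, and the cubes are
the `e`-torsion. -/
theorem intCast_pow_eq_one {p : ℕ} [Fact p.Prime] {e : ℕ} (he : 3 * e = p - 1) {m : ℤ}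
    (hm : ¬ (p : ℤ) ∣ m)
    (h : ∀ q : ℕ, q.Prime → q ≠ p → (q : ZMod p) ^ e ≠ 1 → 3 ∣ padicValInt q m) :
    (m : ZMod p) ^ e = 1 := by
  have hm0 : m ≠ 0 := by
    rintro rfl
    exact hm (dvd_zero _)
  have hpow : ∀ q : ℕ, q.Prime → q ≠ p → (q : ZMod p) ^ (3 * e) = 1 := by
    intro q hq hqp
    rw [he]
    refine ZMod.pow_card_sub_one_eq_one fun h0 => hqp ?_
    rw [ZMod.natCast_eq_zero_iff] at h0
    exact ((Nat.prime_dvd_prime_iff_eq Fact.out hq).1 h0).symm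
  have habs : ((m.natAbs : ℕ) : ZMod p) ^ e = 1 := by
    have hprod := Nat.prod_factorization_pow_eq_self (Int.natAbs_ne_zero.2 hm0)
    rw [← hprod, Finsupp.prod, Nat.cast_prod, ← Finset.prod_pow]
    refine Finset.prod_eq_one fun q hq => ?_
    have hqp : q.Prime := Nat.prime_of_mem_primeFactors hq
    have hdvd : q ∣ m.natAbs := Nat.dvd_of_mem_primeFactors hq
    have hne : q ≠ p := by
      rintro rfl
      exact hm (Int.natCast_dvd.2 hdvd)
    rw [Nat.cast_pow, ← pow_mul]
    by_cases hq1 : (q : ZMod p) ^ e = 1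
    · rw [mul_comm, pow_mul, hq1, one_pow]
    · obtain ⟨k, hk⟩ := h q hqp hne hq1
      have : m.natAbs.factorization q = 3 * k := by
        rw [← hk, padicValInt, Nat.factorization_def _ hqp]
      rw [this, mul_right_comm, pow_mul, hpow q hqp hne, one_pow]
  -- The sign of `m` is harmless, `-1` being a cube.
  have heven : Even e := by
    have hodd : p ≠ 2 := by
      intro h2
      omega
    have := (Fact.out : p.Prime).even_sub_one hodd
    rw [← he] at this
    exact (Nat.even_mul.1 this).resolve_left (by decide)
  rcases Int.natAbs_eq m with h' | h'
  · rw [h']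
    exact_mod_cast habs
  · rw [h', Int.cast_neg, heven.neg_pow]
    exact_mod_cast habs

theorem exists_pow_three_eq {p : ℕ} [Fact p.Prime] {e : ℕ} (he : 3 * e = p - 1) {x : ZMod p}
    (hx : x ^ e = 1) : ∃ c : (ZMod p)ˣ, x = (c : ZMod p) ^ 3 := by
  have hp1 := (Fact.out : p.Prime).one_lt
  have he0 : e ≠ 0 := by omega
  obtain ⟨u, rfl⟩ := IsUnit.of_pow_eq_one hx he0
  have hu : u ^ e = 1 := Units.ext (by simpa using hx)
  obtain ⟨g, hg⟩ := IsCyclic.exists_generator (α := (ZMod p)ˣ)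
  obtain ⟨k, hk⟩ := mem_powers_iff_mem_zpowers.2 (hg u)
  simp only at hk
  have hord : orderOf g = 3 * e := by
    rw [orderOf_eq_card_of_forall_mem_zpowers hg, Nat.card_eq_fintype_card, ZMod.card_units, he]
  rw [← hk, ← pow_mul] at hu
  have hdvd := orderOf_dvd_of_pow_eq_one hu
  rw [hord] at hdvd
  obtain ⟨j, rfl⟩ := Nat.dvd_of_mul_dvd_mul_right (Nat.pos_of_ne_zero he0) hdvd
  refine ⟨g ^ j, ?_⟩
  rw [← hk]
  push_cast
  rw [← pow_mul, mul_comm]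

/-- The reduction of a rational point at `p`. The cubic is Eisenstein at `p`, and irreducible
modulo every prime `q ≠ p` which is not a cube modulo `p`. -/
theorem cube_of_primitive_point {p : ℕ} [Fact p.Prime] {e : ℕ} (he : 3 * e = p - 1)
    {e₁ e₂ e₃ a₁ a₂ d₁ d₂ x y z w : ℤ}
    (h₁ : (p : ℤ) ∣ e₁) (h₂ : (p : ℤ) ∣ e₂) (h₃ : (p : ℤ) ∣ e₃)
    (hf : ∀ (q : ℕ) [Fact q.Prime], q ≠ p → (q : ZMod p) ^ e ≠ 1 →
      ∀ r : ZMod q, (monicCubic (e₁ : ZMod q) e₂ e₃).eval r ≠ 0)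
    (hgcd : Int.gcd d₁ d₂ = 1)
    (h : surfaceValue e₁ e₂ e₃ a₁ a₂ d₁ d₂ x y z w = 0)
    (hprim : ∀ q : ℕ, q.Prime → ¬ ((q : ℤ) ∣ x ∧ (q : ℤ) ∣ y ∧ (q : ℤ) ∣ z ∧ (q : ℤ) ∣ w))
    (hx : ¬ (p : ℤ) ∣ x) :
    (rootPoly (ZMod p) a₁ a₂ d₁ d₂).eval ((w : ZMod p) / x) = 0 ∧
      ∃ c : (ZMod p)ˣ, ((a₁ : ZMod p) + d₁ * ((w : ZMod p) / x)) / ((w : ZMod p) / x) =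
        (c : ZMod p) ^ 3 := by
  have hpp := (Fact.out : p.Prime)
  have hx' : (x : ZMod p) ≠ 0 := by rwa [Ne, ZMod.intCast_zmod_eq_zero_iff_dvd]
  have hred := map_surfaceValue (Int.castRingHom (ZMod p)) e₁ e₂ e₃ a₁ a₂ d₁ d₂ x y z w
  rw [h, map_zero] at hred
  simp only [eq_intCast, surfaceValue, cubicNorm, (ZMod.intCast_zmod_eq_zero_iff_dvd _ _).2 h₁,
    (ZMod.intCast_zmod_eq_zero_iff_dvd _ _).2 h₂, (ZMod.intCast_zmod_eq_zero_iff_dvd _ _).2 h₃]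
    at hred
  have hmul : (w : ZMod p) * (a₁ * x + d₁ * w) * (a₂ * x + d₂ * w) = x ^ 3 := by
    linear_combination -hred
  have hne : (w : ZMod p) * (a₁ * x + d₁ * w) * (a₂ * x + d₂ * w) ≠ 0 := by
    rw [hmul]
    exact pow_ne_zero 3 hx'
  have hw' : (w : ZMod p) ≠ 0 := left_ne_zero_of_mul (left_ne_zero_of_mul hne)
  have hA' : (a₁ * x + d₁ * w : ZMod p) ≠ 0 := right_ne_zero_of_mul (left_ne_zero_of_mul hne)
  have hN : w * (a₁ * x + d₁ * w) * (a₂ * x + d₂ * w) = cubicNorm e₁ e₂ e₃ x y z := by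
    simp only [surfaceValue, Int.cast_id] at h
    linear_combination h
  have hN0 : w * (a₁ * x + d₁ * w) * (a₂ * x + d₂ * w) ≠ 0 := by
    intro h0
    apply hne
    exact_mod_cast congrArg (Int.cast : ℤ → ZMod p) h0
  have hw0 : w ≠ 0 := left_ne_zero_of_mul (left_ne_zero_of_mul hN0)
  have hA0 : a₁ * x + d₁ * w ≠ 0 := right_ne_zero_of_mul (left_ne_zero_of_mul hN0)
  have hB0 : a₂ * x + d₂ * w ≠ 0 := right_ne_zero_of_mul hN0
  -- `(a₁ + d₁ s) / s` is `(a₁ x + d₁ w) w ^ 2` up to the cube `w ^ 3`.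
  have hcube : (((a₁ * x + d₁ * w) * w ^ 2 : ℤ) : ZMod p) ^ e = 1 := by
    refine intCast_pow_eq_one he ?_ fun q hq hqp hqe => ?_
    · rw [← ZMod.intCast_zmod_eq_zero_iff_dvd]
      push_cast
      exact mul_ne_zero hA' (pow_ne_zero 2 hw')
    · have : Fact q.Prime := ⟨hq⟩
      have hv := three_dvd_padicValInt_cubicNorm (hf q hqp hqe) _ x y z rfl
      have hval := congrArg (padicValInt q) hN
      rw [padicValInt.mul (mul_ne_zero hw0 hA0) hB0, padicValInt.mul hw0 hA0] at hval
      rw [padicValInt.mul hA0 (pow_ne_zero 2 hw0), padicValInt_pow]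
      have hqprime := Nat.prime_iff_prime_int.1 hq
      -- If `q` divides `x, y, z`, then it does not divide `w`, nor one of the linear factors, since
      -- `d₁` and `d₂` are coprime; so the other factor carries the whole valuation of the norm.
      -- Otherwise the norm is a unit at `q`, and so are the factors.
      by_cases hall : (q : ℤ) ∣ x ∧ (q : ℤ) ∣ y ∧ (q : ℤ) ∣ z
      · have hqw : ¬ (q : ℤ) ∣ w := fun hqw => hprim q hq ⟨hall.1, hall.2.1, hall.2.2, hqw⟩
        have hw1 := padicValInt.eq_zero_of_not_dvd hqw
        have hlin : ∀ a d : ℤ, ¬ (q : ℤ) ∣ d → padicValInt q (a * x + d * w) = 0 := by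
          intro a d hd
          refine padicValInt.eq_zero_of_not_dvd fun hdvd => ?_
          rw [dvd_add_right (hall.1.mul_left a)] at hdvd
          exact (hqprime.dvd_or_dvd hdvd).elim hd hqw
        by_cases hd₁ : (q : ℤ) ∣ d₁
        · have hd₂ : ¬ (q : ℤ) ∣ d₂ := by
            intro hd₂
            have := Int.dvd_coe_gcd hd₁ hd₂
            rw [hgcd] at this
            exact hqprime.not_dvd_one this
          have := hlin a₂ d₂ hd₂
          omega
        · have := hlin a₁ d₁ hd₁
          omega
      · have hunit : padicValInt q (cubicNorm e₁ e₂ e₃ x y z) = 0 := by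
          refine padicValInt.eq_zero_of_not_dvd fun hdvd => hall ?_
          rw [← ZMod.intCast_zmod_eq_zero_iff_dvd, ← eq_intCast (Int.castRingHom (ZMod q)),
            map_cubicNorm] at hdvd
          have := eq_zero_of_cubicNorm_eq_zero (hf q hqp hqe) hdvd
          simpa [ZMod.intCast_zmod_eq_zero_iff_dvd] using this
        omega
  obtain ⟨c, hc⟩ := exists_pow_three_eq he hcube
  refine ⟨?_, c / Units.mk0 (w : ZMod p) hw', ?_⟩
  · simp [rootPoly]
    field_simp
    linear_combination hmul
  · push_cast at hc ⊢
    rw [div_pow, ← hc]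
    simp only [Units.val_mk0]
    field_simp

/-! ### Gaussian periods -/

section Periods

variable {p : ℕ} [Fact p.Prime] {e : ℕ}

/-- The `e`-torsion of `(ℤ/p)ˣ`; for `3 e = p - 1` these are the cubes. -/
def torsionUnits (p : ℕ) [Fact p.Prime] (e : ℕ) : Finset (ZMod p)ˣ :=
  Finset.univ.filter fun h => h ^ e = 1

theorem mem_torsionUnits {h : (ZMod p)ˣ} : h ∈ torsionUnits p e ↔ h ^ e = 1 := by
  simp [torsionUnits]

/-- The polynomial `∑_h (X ^ (g h) - 1)`, with `h` running through the `e`-torsion of `(ℤ/p)ˣ` and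
exponents reduced to `[0, p)`. Its values at the primitive `p`-th roots of unity are the conjugates
of the Gaussian period, shifted by an integer. -/
noncomputable def periodPoly (e : ℕ) (g : (ZMod p)ˣ) : ℤ[X] :=
  ∑ h ∈ torsionUnits p e, (X ^ ((g * h : (ZMod p)ˣ) : ZMod p).val - 1)

theorem aeval_periodPoly {R : Type*} [CommRing R] (z : R) (g : (ZMod p)ˣ) :
    aeval z (periodPoly e g) =
      ∑ h ∈ torsionUnits p e, (z ^ ((g * h : (ZMod p)ˣ) : ZMod p).val - 1) := by
  simp [periodPoly]

theorem periodPoly_mul_right (g : (ZMod p)ˣ) {u : (ZMod p)ˣ} (hu : u ^ e = 1) :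
    periodPoly e (g * u) = periodPoly e g := by
  refine Finset.sum_bij' (fun h _ => u * h) (fun h _ => u⁻¹ * h) ?_ ?_ ?_ ?_ ?_
  · intro h hh
    rw [mem_torsionUnits] at hh ⊢
    rw [mul_pow, hu, hh, one_mul]
  · intro h hh
    rw [mem_torsionUnits] at hh ⊢
    rw [mul_pow, inv_pow, hu, hh, inv_one, one_mul]
  · intro h _
    simp
  · intro h _
    simp
  · intro h _
    rw [mul_assoc]

theorem pow_val_natCast_mul {R : Type*} [CommRing R] {z : R} (hz : z ^ p = 1) (q : ℕ)
    (a : ZMod p) : z ^ ((q : ZMod p) * a).val = (z ^ q) ^ a.val := by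
  rw [← pow_mul, ← Nat.mod_add_div (q * a.val) p, pow_add, pow_mul z p, hz, one_pow, mul_one,
    ZMod.val_mul, ZMod.val_natCast, Nat.mul_mod, Nat.mod_mod, ← Nat.mul_mod]

/-- An endomorphism acting on `z` as the `q`-th power permutes the periods. -/
theorem map_aeval_periodPoly {R : Type*} [CommRing R] {z : R} (hz : z ^ p = 1) {q : ℕ}
    {u : (ZMod p)ˣ} (hu : (u : ZMod p) = q) {φ : R →+* R} (hφ : φ z = z ^ q) (g : (ZMod p)ˣ) :
    φ (aeval z (periodPoly e g)) = aeval z (periodPoly e (u * g)) := by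
  simp only [aeval_periodPoly, map_sum, map_sub, map_pow, map_one, hφ]
  refine Finset.sum_congr rfl fun h _ => ?_
  rw [mul_assoc, Units.val_mul u, hu, pow_val_natCast_mul hz]

theorem cyclotomic_dvd_of_aeval_eq_zero {L : Type*} [Field L] [CharZero L]
    {ζ : L} (hζ : IsPrimitiveRoot ζ p) {P : ℤ[X]} (hP : aeval ζ P = 0) :
    cyclotomic p ℤ ∣ P := by
  have hpos := (Fact.out : p.Prime).pos
  rw [cyclotomic_eq_minpoly hζ hpos]
  exact minpoly.isIntegrallyClosed_dvd (hζ.isIntegral hpos) hP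

/-- The periods at all units of `ℤ/p` are not equal to each other, by Fourier inversion on
`ℤ/p`. -/
theorem not_forall_period_eq {k : Type*} [Field k] (hpk : (p : k) ≠ 0) {z : k}
    (hz : IsPrimitiveRoot z p) (he : 3 * e = p - 1) (c : k)
    (hc : ∀ a : (ZMod p)ˣ, aeval z (periodPoly e a) = c) : False := by
  classical
  have hp1 := (Fact.out : p.Prime).one_lt
  have hψ := AddChar.zmodChar_primitive_of_primitive_root p hz
  set ψ := AddChar.zmodChar p ((IsPrimitiveRoot.iff_def z p).mp hz).left with hψdef
  have hval : ∀ a, z ^ (ZMod.val a) = ψ a := fun a => (AddChar.zmodChar_apply _ a).symm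
  obtain ⟨N, hN⟩ : ∃ N : k, ∀ a : (ZMod p)ˣ, ∑ h ∈ torsionUnits p e, ψ (a * h) = N := by
    refine ⟨c + (torsionUnits p e).card, fun a => ?_⟩
    rw [← hc a, aeval_periodPoly, Finset.sum_sub_distrib]
    simp [hval]
  -- The Fourier coefficient at `b` of the constant function: it does not depend on `b`, but detects
  -- whether `b` is in the `e`-torsion.
  have key : ∀ b : (ZMod p)ˣ, (if b ∈ torsionUnits p e then (p : k) else 0) =
      (torsionUnits p e).card - N := by
    intro b
    have h1 : ∑ x : ZMod p, ∑ h ∈ torsionUnits p e, ψ (x * (h - b)) =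
        if b ∈ torsionUnits p e then (p : k) else 0 := by
      rw [Finset.sum_comm]
      simp only [AddChar.sum_mulShift _ hψ, sub_eq_zero, Units.val_inj, ZMod.card]
      simp
    have h2 : ∀ x : ZMod p, ∑ h ∈ torsionUnits p e, ψ (x * (h - b)) =
        if x = 0 then ((torsionUnits p e).card : k) else ψ (x * (-b)) * N := by
      intro x
      split_ifs with hx
      · simp [hx]
      · rw [← hN (Units.mk0 x hx), Finset.mul_sum]
        refine Finset.sum_congr rfl fun h _ => ?_
        rw [← AddChar.map_add_eq_mul]
        congr 1
        simp only [Units.val_mk0]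
        ring
    have h3 := AddChar.sum_mulShift (-(b : ZMod p)) hψ
    rw [if_neg (neg_ne_zero.2 b.ne_zero), ← Finset.add_sum_erase _ _ (Finset.mem_univ 0)] at h3
    rw [← h1, Finset.sum_congr rfl fun x _ => h2 x,
      ← Finset.add_sum_erase _ _ (Finset.mem_univ 0), if_pos rfl,
      Finset.sum_congr rfl fun x hx => if_neg (Finset.ne_of_mem_erase hx), ← Finset.sum_mul]
    simp only [zero_mul, AddChar.map_zero_eq_one] at h3
    linear_combination N * h3
  obtain ⟨g, hg⟩ := IsCyclic.exists_generator (α := (ZMod p)ˣ)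
  have hg' : g ∉ torsionUnits p e := by
    intro h
    rw [mem_torsionUnits] at h
    have hord := orderOf_eq_card_of_forall_mem_zpowers hg
    rw [Nat.card_eq_fintype_card, ZMod.card_units] at hord
    have := Nat.le_of_dvd (by omega) (orderOf_dvd_of_pow_eq_one h)
    omega
  have h1 := key 1
  have h2 := key g
  rw [if_pos (mem_torsionUnits.2 (one_pow e))] at h1
  rw [if_neg hg'] at h2
  exact hpk (h1.trans h2.symm)

/-- If `q` is not a cube modulo `p`, a period in characteristic `q` does not lie in `𝔽_q`:
otherwise the Frobenius, which permutes the three periods transitively, would fix them. -/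
theorem period_pow_ne {q : ℕ} [Fact q.Prime] (hqp : q ≠ p) (he : 3 * e = p - 1)
    (hq : (q : ZMod p) ^ e ≠ 1) {k : Type*} [Field k] [CharP k q] {z : k}
    (hz : IsPrimitiveRoot z p) (g : (ZMod p)ˣ) :
    aeval z (periodPoly e g) ^ q ≠ aeval z (periodPoly e g) := by
  intro hfix
  have hp := (Fact.out : p.Prime)
  have hpk : (p : k) ≠ 0 := by
    rw [Ne, CharP.cast_eq_zero_iff k q, Nat.prime_dvd_prime_iff_eq Fact.out hp]
    exact hqp
  have hq0 : (q : ZMod p) ≠ 0 := by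
    rw [Ne, ZMod.natCast_eq_zero_iff, Nat.prime_dvd_prime_iff_eq hp Fact.out]
    exact hqp.symm
  have hfrob : ∀ a : (ZMod p)ˣ, aeval z (periodPoly e a) ^ q =
      aeval z (periodPoly e (Units.mk0 (q : ZMod p) hq0 * a)) := by
    intro a
    exact map_aeval_periodPoly (φ := frobenius k q) hz.pow_eq_one (Units.val_mk0 hq0) rfl a
  set u := Units.mk0 (q : ZMod p) hq0 with hu
  have hiter : ∀ i : ℕ, aeval z (periodPoly e (u ^ i * g)) = aeval z (periodPoly e g) := by
    intro i
    induction i with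
    | zero => simp
    | succ i ih => rw [pow_succ', mul_assoc, ← hfrob, ih, hfix]
  refine not_forall_period_eq hpk hz he (aeval z (periodPoly e g)) fun a => ?_
  have hcard : ∀ x : (ZMod p)ˣ, (x ^ e) ^ 3 = 1 := by
    intro x
    rw [← pow_mul, mul_comm, he]
    exact ZMod.units_pow_card_sub_one_eq_one p x
  -- The group of cubic residue symbols has order three, and is generated by that of `q`.
  obtain ⟨i, hi⟩ : ∃ i : ℕ, ((u ^ i * g) ^ e : (ZMod p)ˣ) = a ^ e := by
    have hv3 : ((u ^ e : (ZMod p)ˣ) : ZMod p) ^ 3 = 1 := by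
      rw [← Units.val_pow_eq_pow_val, hcard, Units.val_one]
    have hv1 : ((u ^ e : (ZMod p)ˣ) : ZMod p) ≠ 1 := by
      rw [Units.val_pow_eq_pow_val]
      exact hq
    have hw3 : (((a / g) ^ e : (ZMod p)ˣ) : ZMod p) ^ 3 = 1 := by
      rw [← Units.val_pow_eq_pow_val, hcard, Units.val_one]
    generalize hv : ((u ^ e : (ZMod p)ˣ) : ZMod p) = v at hv3 hv1
    generalize hw : (((a / g) ^ e : (ZMod p)ˣ) : ZMod p) = w at hw3
    have hquad : v ^ 2 + v + 1 = 0 := by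
      refine (mul_eq_zero.1 (?_ : (v - 1) * (v ^ 2 + v + 1) = 0)).resolve_left (sub_ne_zero.2 hv1)
      linear_combination hv3
    have hprod : (w - 1) * ((w - v) * (w - v ^ 2)) = 0 := by
      linear_combination hw3 + (-w ^ 2 + w) * hquad + (w - 1) * hv3
    have hpow : ∀ i : ℕ, w = v ^ i → ((u ^ i * g) ^ e : (ZMod p)ˣ) = a ^ e := by
      intro i hi
      have : (a / g) ^ e = (u ^ e) ^ i := by
        ext
        rw [hw, hi, Units.val_pow_eq_pow_val (u ^ e), hv]
      rw [mul_pow, ← pow_mul, mul_comm i e, pow_mul, ← this, div_pow, div_mul_cancel]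
    rcases mul_eq_zero.1 hprod with h | h
    · exact ⟨0, hpow 0 (by rw [pow_zero]; exact sub_eq_zero.1 h)⟩
    · rcases mul_eq_zero.1 h with h | h
      · exact ⟨1, hpow 1 (by rw [pow_one]; exact sub_eq_zero.1 h)⟩
      · exact ⟨2, hpow 2 (sub_eq_zero.1 h)⟩
  rw [← hiter i, ← periodPoly_mul_right (u ^ i * g) (u := (u ^ i * g)⁻¹ * a), mul_inv_cancel_left]
  rw [mul_pow, inv_pow, hi, inv_mul_cancel]

/-- The three polynomials `periodPoly e gᵢ` have elementary symmetric functions `e₁, e₂, e₃`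
modulo the cyclotomic polynomial. Stating this in `ℤ[X]` makes it available in every ring with a
root of the cyclotomic polynomial: in characteristic `q`, in Witt vectors, and at `1` in
characteristic `p`. -/
structure IsPeriodCubic (e : ℕ) (g₁ g₂ g₃ : (ZMod p)ˣ) (e₁ e₂ e₃ : ℤ) : Prop where
  sum : cyclotomic p ℤ ∣ periodPoly e g₁ + periodPoly e g₂ + periodPoly e g₃ - C e₁
  sum_mul : cyclotomic p ℤ ∣ periodPoly e g₁ * periodPoly e g₂ +
    periodPoly e g₁ * periodPoly e g₃ + periodPoly e g₂ * periodPoly e g₃ - C e₂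
  prod : cyclotomic p ℤ ∣ periodPoly e g₁ * periodPoly e g₂ * periodPoly e g₃ - C e₃

omit [Fact p.Prime] in
theorem aeval_eq_intCast_of_dvd {R : Type*} [CommRing R] {z : R}
    (hz : aeval z (cyclotomic p ℤ) = 0) {P : ℤ[X]} {n : ℤ} (h : cyclotomic p ℤ ∣ P - C n) :
    (n : R) = aeval z P := by
  obtain ⟨Q, hQ⟩ := h
  have := congrArg (aeval z) hQ
  rw [map_mul, hz, zero_mul, map_sub, aeval_C, eq_intCast, sub_eq_zero] at this
  exact this.symm

variable {g₁ g₂ g₃ : (ZMod p)ˣ} {e₁ e₂ e₃ : ℤ}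

theorem IsPeriodCubic.eval_monicCubic (h : IsPeriodCubic e g₁ g₂ g₃ e₁ e₂ e₃) {R : Type*}
    [CommRing R] {z : R} (hz : aeval z (cyclotomic p ℤ) = 0) (r : R) :
    (monicCubic (e₁ : R) e₂ e₃).eval r =
      (r - aeval z (periodPoly e g₁)) * (r - aeval z (periodPoly e g₂)) *
        (r - aeval z (periodPoly e g₃)) :=
  eval_monicCubic_eq_mul
    (by simpa using aeval_eq_intCast_of_dvd hz h.sum)
    (by simpa using aeval_eq_intCast_of_dvd hz h.sum_mul)
    (by simpa using aeval_eq_intCast_of_dvd hz h.prod) r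

theorem aeval_cyclotomic_of_isPrimitiveRoot {k : Type*} [CommRing k] [IsDomain k] {z : k}
    (hz : IsPrimitiveRoot z p) : aeval z (cyclotomic p ℤ) = 0 := by
  have := hz.isRoot_cyclotomic (Fact.out : p.Prime).pos
  rwa [IsRoot, ← map_cyclotomic_int, eval_map, ← algebraMap_int_eq, ← aeval_def] at this

theorem neZero_of_prime_ne {q : ℕ} [Fact q.Prime] (hqp : q ≠ p) (k : Type*) [Field k] [CharP k q] :
    NeZero (p : k) := by
  refine ⟨?_⟩
  rw [Ne, CharP.cast_eq_zero_iff k q, Nat.prime_dvd_prime_iff_eq Fact.out Fact.out]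
  exact hqp

/-- The cubic of the periods has no root modulo a prime `q ≠ p` which is not a cube modulo `p`. -/
theorem IsPeriodCubic.eval_ne_zero (h : IsPeriodCubic e g₁ g₂ g₃ e₁ e₂ e₃) (he : 3 * e = p - 1)
    {q : ℕ} [Fact q.Prime] (hqp : q ≠ p) (hq : (q : ZMod p) ^ e ≠ 1) (r : ZMod q) :
    (monicCubic (e₁ : ZMod q) e₂ e₃).eval r ≠ 0 := by
  intro hr
  have := neZero_of_prime_ne hqp (AlgebraicClosure (ZMod q))
  obtain ⟨z, hz⟩ := HasEnoughRootsOfUnity.exists_primitiveRoot (AlgebraicClosure (ZMod q)) p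
  have hr' := congrArg (algebraMap (ZMod q) (AlgebraicClosure (ZMod q))) hr
  rw [← eval₂_at_apply, ← eval_map, map_zero] at hr'
  have hmap : (monicCubic (e₁ : ZMod q) e₂ e₃).map
      (algebraMap (ZMod q) (AlgebraicClosure (ZMod q))) =
      monicCubic (e₁ : AlgebraicClosure (ZMod q)) e₂ e₃ := by simp [monicCubic]
  rw [hmap, h.eval_monicCubic (aeval_cyclotomic_of_isPrimitiveRoot hz), mul_eq_zero,
    mul_eq_zero] at hr'
  have hpow : algebraMap (ZMod q) (AlgebraicClosure (ZMod q)) r ^ q = algebraMap _ _ r := by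
    rw [← map_pow, ZMod.pow_card]
  rcases hr' with (h' | h') | h' <;> rw [sub_eq_zero] at h' <;> rw [h'] at hpow
  · exact period_pow_ne hqp he hq hz g₁ hpow
  · exact period_pow_ne hqp he hq hz g₂ hpow
  · exact period_pow_ne hqp he hq hz g₃ hpow

/-- The cubic of the periods has a root in `ℤ_q` if the prime `q ≠ p` is a cube modulo `p`: the
period of the Teichmüller representative of a primitive `p`-th root of unity is fixed by the
Frobenius of the Witt vectors, hence lies in `W(𝔽_q) = ℤ_q`. -/
theorem IsPeriodCubic.exists_padicInt_root (h : IsPeriodCubic e g₁ g₂ g₃ e₁ e₂ e₃)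
    {q : ℕ} [Fact q.Prime] (hqp : q ≠ p) (hq : (q : ZMod p) ^ e = 1) :
    ∃ r : ℤ_[q], (monicCubic (e₁ : ℤ_[q]) e₂ e₃).eval r = 0 := by
  have hp := (Fact.out : p.Prime)
  have := neZero_of_prime_ne hqp (AlgebraicClosure (ZMod q))
  obtain ⟨z, hz⟩ := HasEnoughRootsOfUnity.exists_primitiveRoot (AlgebraicClosure (ZMod q)) p
  have hq0 : (q : ZMod p) ≠ 0 := by
    rw [Ne, ZMod.natCast_eq_zero_iff, Nat.prime_dvd_prime_iff_eq hp Fact.out]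
    exact hqp.symm
  set Z : WittVector q (AlgebraicClosure (ZMod q)) := WittVector.teichmuller q z with hZ
  have hZp : Z ^ p = 1 := by rw [hZ, ← map_pow, hz.pow_eq_one, map_one]
  have hZ1 : Z ≠ 1 := by
    intro h1
    apply hz.ne_one hp.one_lt
    have := congrArg (fun w => WittVector.coeff w 0) h1
    simpa [hZ, WittVector.teichmuller_coeff_zero] using this
  have hcyc : aeval Z (cyclotomic p ℤ) = 0 := by
    have := congrArg (aeval Z) (cyclotomic_prime_mul_X_sub_one ℤ p)
    rw [map_mul] at this
    refine (mul_eq_zero.1 (this.trans ?_)).resolve_right ?_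
    · simp [hZp]
    · simpa [sub_eq_zero] using hZ1
  have hfix : WittVector.frobenius (aeval Z (periodPoly e g₁)) = aeval Z (periodPoly e g₁) := by
    rw [map_aeval_periodPoly (φ := WittVector.frobenius) hZp (u := Units.mk0 (q : ZMod p) hq0) rfl
      (by rw [hZ, WittVector.frobenius_eq_map_frobenius, WittVector.map_teichmuller, frobenius_def,
        map_pow]), mul_comm, periodPoly_mul_right]
    ext
    simpa using hq
  have hcoeff : ∀ n, ∃ a : ZMod q, algebraMap (ZMod q) (AlgebraicClosure (ZMod q)) a =
      (aeval Z (periodPoly e g₁)).coeff n := by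
    intro n
    have hn : (aeval Z (periodPoly e g₁)).coeff n ^ q = (aeval Z (periodPoly e g₁)).coeff n := by
      rw [← WittVector.coeff_frobenius_charP, hfix]
    rw [← Subfield.mem_bot_iff_pow_eq_self, ← ZMod.fieldRange_castHom_eq_bot q] at hn
    obtain ⟨a, ha⟩ := hn
    exact ⟨a, ha ▸ RingHom.congr_fun (Subsingleton.elim _ _) a⟩
  choose a ha using hcoeff
  set w : WittVector q (ZMod q) := WittVector.mk q a with hw
  have hmap : WittVector.map (algebraMap (ZMod q) (AlgebraicClosure (ZMod q))) w =
      aeval Z (periodPoly e g₁) := by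
    ext n
    rw [WittVector.map_coeff, hw, WittVector.coeff_mk, ha]
  have hroot : (monicCubic (e₁ : WittVector q (ZMod q)) e₂ e₃).eval w = 0 := by
    apply WittVector.map_injective _ (algebraMap (ZMod q) (AlgebraicClosure (ZMod q))).injective
    have hev := h.eval_monicCubic hcyc (aeval Z (periodPoly e g₁))
    rw [sub_self, zero_mul, zero_mul] at hev
    rw [map_zero, ← hev, ← hmap]
    simp [MordellSurface.eval_monicCubic]
  refine ⟨WittVector.equiv q w, ?_⟩
  have := congrArg (WittVector.equiv q) hroot
  simpa [MordellSurface.eval_monicCubic] using this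

end Periods

/-! ### The cubic of the periods is Eisenstein -/

/-- The operator `X d/dX` on polynomials. -/
noncomputable def eulerOperator (F : Type*) [CommRing F] : Module.End F F[X] :=
  LinearMap.mulLeft F X ∘ₗ derivative

theorem eulerOperator_apply {F : Type*} [CommRing F] (P : F[X]) :
    eulerOperator F P = X * derivative P := rfl

theorem eulerOperator_pow_X_pow {F : Type*} [CommRing F] (n m : ℕ) :
    (eulerOperator F ^ n) (X ^ m) = C ((m : F) ^ n) * X ^ m := by
  induction n with
  | zero => simp
  | succ n ih =>
    rw [pow_succ', Module.End.mul_apply, ih, eulerOperator_apply, derivative_C_mul_X_pow]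
    rcases m with _ | m
    · simp
    · simp only [map_mul, map_pow, map_natCast, Nat.add_sub_cancel]
      ring

theorem pow_dvd_eulerOperator_pow {F : Type*} [CommRing F] {Q : F[X]} (n m : ℕ) :
    ∀ {P : F[X]}, Q ^ (m + n) ∣ P → Q ^ m ∣ (eulerOperator F ^ n) P := by
  induction n with
  | zero => simp
  | succ n ih =>
    intro P hP
    rw [pow_succ, Module.End.mul_apply]
    refine ih ?_
    rw [eulerOperator_apply]
    exact (pow_sub_one_dvd_derivative_of_pow_dvd hP).mul_left X

section

variable {p : ℕ} [Fact p.Prime] {e : ℕ}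

/-- In characteristic `p` the period polynomials vanish at `1` to order at most `e`: applying
`X d/dX` to it `e` times gives a multiple of `∑_h X ^ (g h)`, with nonzero value at `1`. -/
theorem not_pow_dvd_periodPoly (he : 3 * e = p - 1) (g : (ZMod p)ˣ) :
    ¬ (X - 1) ^ (e + 1) ∣ (periodPoly e g).map (Int.castRingHom (ZMod p)) := by
  intro hdvd
  have hp1 := (Fact.out : p.Prime).one_lt
  have he0 : e ≠ 0 := by omega
  rw [add_comm] at hdvd
  have h := pow_dvd_eulerOperator_pow e 1 hdvd
  rw [pow_one, ← C_1, dvd_iff_isRoot, IsRoot] at h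
  have hmap : (periodPoly e g).map (Int.castRingHom (ZMod p)) =
      ∑ h ∈ torsionUnits p e, (X ^ ((g * h : (ZMod p)ˣ) : ZMod p).val - X ^ 0) := by
    simp [periodPoly, Polynomial.map_sum]
  rw [hmap, map_sum, eval_finsetSum] at h
  have hterm : ∀ x ∈ torsionUnits p e, eval 1 ((eulerOperator (ZMod p) ^ e)
      (X ^ ((g * x : (ZMod p)ˣ) : ZMod p).val - X ^ 0)) = (g : ZMod p) ^ e := by
    intro x hx
    rw [mem_torsionUnits] at hx
    rw [map_sub, eulerOperator_pow_X_pow, eulerOperator_pow_X_pow]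
    have hx' : (x : ZMod p) ^ e = 1 := by rw [← Units.val_pow_eq_pow_val, hx, Units.val_one]
    simp [he0, mul_pow, hx']
  rw [Finset.sum_congr rfl hterm, Finset.sum_const, nsmul_eq_mul] at h
  have hcard : ((torsionUnits p e).card : ZMod p) ≠ 0 := by
    rw [Ne, ZMod.natCast_eq_zero_iff]
    refine Nat.not_dvd_of_pos_of_lt ?_ ?_
    · exact Finset.card_pos.2 ⟨1, mem_torsionUnits.2 (one_pow e)⟩
    · have := Finset.card_le_univ (torsionUnits p e)
      rw [ZMod.card_units] at this
      omega
  exact mul_ne_zero hcard (pow_ne_zero e g.ne_zero) h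

theorem _root_.Prime.exists_pow_dvd_of_pow_three_mul_dvd {R : Type*} [CommRing R] [IsDomain R]
    {x : R} (hx : Prime x) {n : ℕ} {a b c : R} (h : x ^ (3 * n) ∣ a * b * c) :
    x ^ n ∣ a ∨ x ^ n ∣ b ∨ x ^ n ∣ c := by
  by_contra! hne
  obtain ⟨ha, hb, hc⟩ := hne
  rw [← emultiplicity_lt_iff_not_dvd] at ha hb hc
  rw [← not_not (a := x ^ (3 * n) ∣ a * b * c), ← emultiplicity_lt_iff_not_dvd] at h
  apply h
  rw [emultiplicity_mul hx, emultiplicity_mul hx]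
  rw [(by ring : 3 * n = n + n + n), Nat.cast_add, Nat.cast_add]
  exact WithTop.add_lt_add (WithTop.add_lt_add ha hb) hc

variable {L : Type*} [Field L] [NumberField L] [IsCyclotomicExtension {p} ℚ L] {ζ : L}

/-- The `(ζ - 1)`-adic valuation of a shifted Gaussian period is at most `e`. -/
theorem not_pow_dvd_aeval_periodPoly (hζ : IsPrimitiveRoot ζ p) (he : 3 * e = p - 1)
    (g : (ZMod p)ˣ) : ¬ (hζ.toInteger - 1) ^ (e + 1) ∣ aeval hζ.toInteger (periodPoly e g) := by
  have hp := (Fact.out : p.Prime)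
  have : NeZero p := ⟨hp.ne_zero⟩
  have hp1 := hp.one_lt
  rintro ⟨b, hb⟩
  have htop := IsCyclotomicExtension.Rat.adjoin_singleton_eq_top hζ
  obtain ⟨B, rfl⟩ : ∃ B : ℤ[X], aeval hζ.toInteger B = b := by
    have hmem : b ∈ Algebra.adjoin ℤ {hζ.toInteger} := htop ▸ Algebra.mem_top
    rwa [Algebra.adjoin_singleton_eq_range_aeval] at hmem
  have hzero : aeval ζ (periodPoly e g - (X - 1) ^ (e + 1) * B) = 0 := by
    have hz : aeval hζ.toInteger (periodPoly e g - (X - 1) ^ (e + 1) * B) = 0 := by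
      rw [map_sub, hb]
      simp
    have := congrArg (algebraMap (𝓞 L) L) hz
    rwa [← aeval_algebraMap_apply, map_zero] at this
  have hdvd := Polynomial.map_dvd (Int.castRingHom (ZMod p))
    (cyclotomic_dvd_of_aeval_eq_zero hζ hzero)
  have hcyc : cyclotomic p (ZMod p) = (X - 1) ^ (p - 1) := by
    have := cyclotomic_mul_prime_eq_pow_of_not_dvd (n := 1) (p := p) (ZMod p) (by
      simpa using hp1.ne')
    rwa [one_mul, cyclotomic_one] at this
  rw [map_cyclotomic, hcyc, Polynomial.map_sub, Polynomial.map_mul] at hdvd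
  refine not_pow_dvd_periodPoly he g ?_
  -- Since `cyclotomic p` is `(X - 1) ^ (p - 1)` modulo `p` and `e + 1 ≤ p - 1`, it does not matter
  -- which polynomial represents the period.
  have h1 := (pow_dvd_pow (X - 1 : (ZMod p)[X]) (by omega : e + 1 ≤ p - 1)).trans hdvd
  refine (dvd_sub_left ?_).1 h1
  simp

variable {g₁ g₂ g₃ : (ZMod p)ˣ} {e₁ e₂ e₃ : ℤ}

/-- The product of the three periods has `(ζ - 1)`-adic valuation at most `3 e = p - 1`, while
`p ^ 2` has valuation `2 (p - 1)`. -/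
theorem IsPeriodCubic.not_sq_dvd (h : IsPeriodCubic e g₁ g₂ g₃ e₁ e₂ e₃) (he : 3 * e = p - 1)
    (hζ : IsPrimitiveRoot ζ p) : ¬ (p : ℤ) ^ 2 ∣ e₃ := by
  intro hdvd
  have hp := (Fact.out : p.Prime)
  have : NeZero p := ⟨hp.ne_zero⟩
  have hp1 := hp.one_lt
  have hcyc := aeval_cyclotomic_of_isPrimitiveRoot hζ.toInteger_isPrimitiveRoot
  have he₃ := aeval_eq_intCast_of_dvd hcyc h.prod
  have hdvd' := map_dvd (Int.castRingHom (𝓞 L)) hdvd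
  rw [eq_intCast, eq_intCast, he₃, map_mul, map_mul, Int.cast_pow, Int.cast_natCast] at hdvd'
  have hass := (IsCyclotomicExtension.Rat.associated_zeta_sub_one_pow_prime p hζ).dvd
  have hpow : (hζ.toInteger - 1) ^ (3 * (e + 1)) ∣ (p : 𝓞 L) ^ 2 := by
    have h2 := pow_dvd_pow_of_dvd hass 2
    rw [← pow_mul] at h2
    exact (pow_dvd_pow _ (by omega)).trans h2
  rcases hζ.zeta_sub_one_prime'.exists_pow_dvd_of_pow_three_mul_dvd (hpow.trans hdvd') with
    h' | h' | h'
  · exact not_pow_dvd_aeval_periodPoly hζ he g₁ h'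
  · exact not_pow_dvd_aeval_periodPoly hζ he g₂ h'
  · exact not_pow_dvd_aeval_periodPoly hζ he g₃ h'

/-- Modulo `p` the number `1` is a root of the cyclotomic polynomial, and there the period
polynomials vanish. -/
theorem IsPeriodCubic.dvd (h : IsPeriodCubic e g₁ g₂ g₃ e₁ e₂ e₃) :
    (p : ℤ) ∣ e₁ ∧ (p : ℤ) ∣ e₂ ∧ (p : ℤ) ∣ e₃ := by
  have hcyc : aeval (1 : ZMod p) (cyclotomic p ℤ) = 0 := by
    rw [aeval_def, ← eval_map, algebraMap_int_eq, map_cyclotomic_int, eval_one_cyclotomic_prime,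
      CharP.cast_eq_zero]
  simp only [← ZMod.intCast_zmod_eq_zero_iff_dvd]
  rw [aeval_eq_intCast_of_dvd hcyc h.sum, aeval_eq_intCast_of_dvd hcyc h.sum_mul,
    aeval_eq_intCast_of_dvd hcyc h.prod]
  simp [aeval_periodPoly]

end

/-! ### The cubic subfield of the cyclotomic field -/

section Galois

variable {p : ℕ} [Fact p.Prime] {L : Type*} [Field L] [NumberField L]
  [IsCyclotomicExtension {p} ℚ L] {ζ : L} {K : IntermediateField ℚ L}

/-- The exponents through which the Galois group over the cubic subfield acts on `ζ` are the
`e`-torsion of `(ℤ/p)ˣ`, so that the trace is a Gaussian period. -/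
theorem algebraMap_trace_eq (hp : p % 3 = 1) (hζ : IsPrimitiveRoot ζ p)
    (hK : Module.finrank ℚ K = 3) :
    algebraMap K L (Algebra.trace K L (ζ - 1)) =
      aeval ζ (periodPoly ((p - 1) / 3) (1 : (ZMod p)ˣ)) := by
  classical
  have hpp := (Fact.out : p.Prime)
  have hne : NeZero p := ⟨hpp.ne_zero⟩
  have hgal : IsGalois ℚ L := IsCyclotomicExtension.isGalois {p} ℚ _
  have hgal' : IsGalois K L := IsGalois.tower_top_of_isGalois ℚ K _
  have hpos : 0 < (p - 1) / 3 := by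
    have := hpp.two_le
    omega
  have hfin : Module.finrank K L = (p - 1) / 3 := by
    have h1 := Module.finrank_mul_finrank ℚ K L
    rw [hK, IsCyclotomicExtension.Rat.finrank p L, Nat.totient_prime hpp] at h1
    omega
  have hinj : Function.Injective (hζ.autToPow K) := by
    intro σ τ h
    have hζστ : σ ζ = τ ζ := by rw [← hζ.autToPow_spec K σ, ← hζ.autToPow_spec K τ, h]
    have : ((σ.restrictScalars ℚ : L ≃ₐ[ℚ] L) : L →ₐ[ℚ] L) = (τ.restrictScalars ℚ : L ≃ₐ[ℚ] L) :=
      (hζ.powerBasis ℚ).algHom_ext (by simpa using hζστ)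
    ext x
    exact DFunLike.congr_fun this x
  have himage : Finset.univ.image (hζ.autToPow K) = torsionUnits p ((p - 1) / 3) := by
    refine Finset.eq_of_subset_of_card_le ?_ ?_
    · intro h hh
      obtain ⟨σ, -, rfl⟩ := Finset.mem_image.1 hh
      rw [mem_torsionUnits, ← map_pow, ← hfin, ← IsGalois.card_aut_eq_finrank,
        pow_card_eq_one', map_one]
    · rw [Finset.card_image_of_injective _ hinj, Finset.card_univ, ← Nat.card_eq_fintype_card,
        IsGalois.card_aut_eq_finrank, hfin]
      exact IsCyclic.card_pow_eq_one_le hpos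
  rw [trace_eq_sum_automorphisms, aeval_periodPoly, ← himage,
    Finset.sum_image fun σ _ τ _ h => hinj h]
  refine Finset.sum_congr rfl fun σ _ => ?_
  rw [one_mul, hζ.autToPow_spec K, map_sub, map_one]

/-- The conjugates of the trace are shifted Gaussian periods. -/
theorem exists_algebraMap_conj_eq [IsGalois ℚ K] (hp : p % 3 = 1) (hζ : IsPrimitiveRoot ζ p)
    (hK : Module.finrank ℚ K = 3) (σ : K ≃ₐ[ℚ] K) :
    ∃ g : (ZMod p)ˣ, algebraMap K L
      (σ (Algebra.trace K L (ζ - 1))) =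
        aeval ζ (periodPoly ((p - 1) / 3) g) := by
  have hpp := (Fact.out : p.Prime)
  have hne : NeZero p := ⟨hpp.ne_zero⟩
  have hgal : IsGalois ℚ L := IsCyclotomicExtension.isGalois {p} ℚ _
  obtain ⟨τ, rfl⟩ := AlgEquiv.restrictNormalHom_surjective (F := ℚ) (K₁ := K)
    (E := L) σ
  refine ⟨hζ.autToPow ℚ τ * 1, ?_⟩
  have h1 : algebraMap K L ((AlgEquiv.restrictNormalHom K τ)
      (Algebra.trace K L (ζ - 1))) =
      τ (algebraMap K _ (Algebra.trace K L (ζ - 1))) :=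
    AlgEquiv.restrictNormal_commutes τ K _
  rw [h1, algebraMap_trace_eq hp hζ hK]
  exact map_aeval_periodPoly (φ := (τ : L →+* L))
    (q := (hζ.autToPow ℚ τ : ZMod p).val) hζ.pow_eq_one (by simp)
    (hζ.autToPow_spec ℚ τ).symm 1

theorem exists_intCast_eq_of_isIntegral {F : Type*} [Field F] [Algebra ℚ F] {q : ℚ}
    (h : IsIntegral ℤ (algebraMap ℚ F q)) : ∃ n : ℤ, (n : F) = algebraMap ℚ F q := by
  rw [isIntegral_algebraMap_iff (algebraMap ℚ F).injective, IsIntegrallyClosed.isIntegral_iff] at h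
  obtain ⟨n, rfl⟩ := h
  exact ⟨n, by simp⟩

/-- The norm form of the surface, in terms of the cubic with the three periods as roots. -/
theorem exists_isPeriodCubic [IsGalois ℚ K] (hp : p % 3 = 1) (hζ : IsPrimitiveRoot ζ p)
    (hK : Module.finrank ℚ K = 3) {θ : K}
    (hθ : θ = Algebra.trace K L (ζ - 1)) :
    ∃ (g₁ g₂ g₃ : (ZMod p)ˣ) (e₁ e₂ e₃ : ℤ),
      IsPeriodCubic ((p - 1) / 3) g₁ g₂ g₃ e₁ e₂ e₃ ∧
      normForm ℚ θ = cubicNorm (MvPolynomial.C (e₁ : ℚ)) (MvPolynomial.C (e₂ : ℚ))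
        (MvPolynomial.C (e₃ : ℚ)) (MvPolynomial.X 0) (MvPolynomial.X 1) (MvPolynomial.X 2) ∧
      (monicCubic (e₁ : K) e₂ e₃).eval θ = 0 ∧ IsIntegral ℤ θ := by
  have hconj := exists_algebraMap_conj_eq hp hζ hK
  rw [← hθ] at hconj
  have hcard : Fintype.card (K ≃ₐ[ℚ] K) = 3 := by
    rw [← Nat.card_eq_fintype_card, IsGalois.card_aut_eq_finrank, hK]
  let E := (Fintype.equivFinOfCardEq hcard).symm
  have hint : IsIntegral ℤ θ := by
    rw [hθ]
    exact Algebra.isIntegral_trace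
      ((hζ.isIntegral (Fact.out : p.Prime).pos).sub isIntegral_one)
  have hintσ : ∀ σ : K ≃ₐ[ℚ] K, IsIntegral ℤ (σ θ) := fun σ => hint.map (σ.restrictScalars ℤ)
  have hsum : ∀ x : K, algebraMap ℚ K (Algebra.trace ℚ K x) = E 0 x + E 1 x + E 2 x := by
    intro x
    rw [trace_eq_sum_automorphisms, ← Equiv.sum_comp E, Fin.sum_univ_three]
  have hprod : algebraMap ℚ K (Algebra.norm ℚ θ) = E 0 θ * E 1 θ * E 2 θ := by
    rw [Algebra.norm_eq_prod_automorphisms, ← Equiv.prod_comp E, Fin.prod_univ_three]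
  have hmul : algebraMap ℚ K ((Algebra.trace ℚ K θ ^ 2 - Algebra.trace ℚ K (θ ^ 2)) / 2) =
      E 0 θ * E 1 θ + E 0 θ * E 2 θ + E 1 θ * E 2 θ := by
    rw [map_div₀, map_sub, map_pow, hsum, hsum, map_ofNat]
    simp only [map_pow]
    ring
  obtain ⟨e₁, he₁⟩ := exists_intCast_eq_of_isIntegral (F := K) (q := Algebra.trace ℚ K θ) (by
    rw [hsum]
    exact ((hintσ _).add (hintσ _)).add (hintσ _))
  obtain ⟨e₂, he₂⟩ := exists_intCast_eq_of_isIntegral (F := K)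
    (q := (Algebra.trace ℚ K θ ^ 2 - Algebra.trace ℚ K (θ ^ 2)) / 2) (by
    rw [hmul]
    exact (((hintσ _).mul (hintσ _)).add ((hintσ _).mul (hintσ _))).add ((hintσ _).mul (hintσ _)))
  obtain ⟨e₃, he₃⟩ := exists_intCast_eq_of_isIntegral (F := K) (q := Algebra.norm ℚ θ) (by
    rw [hprod]
    exact ((hintσ _).mul (hintσ _)).mul (hintσ _))
  rw [hsum] at he₁
  rw [hmul] at he₂
  rw [hprod] at he₃
  obtain ⟨g₁, hg₁⟩ := hconj (E 0)
  obtain ⟨g₂, hg₂⟩ := hconj (E 1)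
  obtain ⟨g₃, hg₃⟩ := hconj (E 2)
  refine ⟨g₁, g₂, g₃, e₁, e₂, e₃, ⟨?_, ?_, ?_⟩, ?_, ?_, hint⟩
  · refine cyclotomic_dvd_of_aeval_eq_zero hζ ?_
    have := congrArg (algebraMap K L) he₁
    simp only [map_add, map_intCast, hg₁, hg₂, hg₃] at this
    simp [this]
  · refine cyclotomic_dvd_of_aeval_eq_zero hζ ?_
    have := congrArg (algebraMap K L) he₂
    simp only [map_add, map_mul, map_intCast, hg₁, hg₂, hg₃] at this
    simp [this]
  · refine cyclotomic_dvd_of_aeval_eq_zero hζ ?_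
    have := congrArg (algebraMap K L) he₃
    simp only [map_mul, map_intCast, hg₁, hg₂, hg₃] at this
    simp [this]
  · apply MvPolynomial.map_injective _ (algebraMap ℚ K).injective
    rw [map_normForm, map_cubicNorm, conjugateProduct, ← Equiv.prod_comp E, Fin.prod_univ_three]
    simp only [MvPolynomial.map_X, map_intCast]
    rw [cubicNorm_eq_mul (r₁ := MvPolynomial.C (E 0 θ)) (r₂ := MvPolynomial.C (E 1 θ))
      (r₃ := MvPolynomial.C (E 2 θ))]
    · simp only [map_pow]
    · rw [← map_intCast (MvPolynomial.C : K →+* MvPolynomial (Fin 4) K), he₁]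
      simp
    · rw [← map_intCast (MvPolynomial.C : K →+* MvPolynomial (Fin 4) K), he₂]
      simp
    · rw [← map_intCast (MvPolynomial.C : K →+* MvPolynomial (Fin 4) K), he₃]
      simp
  · rw [eval_monicCubic_eq_mul he₁ he₂ he₃]
    obtain ⟨i, hi⟩ := E.surjective 1
    have hi' : θ - E i θ = 0 := by simp [hi]
    fin_cases i
    · simp only [Fin.zero_eta] at hi'
      rw [hi', zero_mul, zero_mul]
    · simp only [Fin.mk_one] at hi'
      rw [hi', mul_zero, zero_mul]
    · simp only [Fin.reduceFinMk] at hi'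
      rw [hi', mul_zero]

/-- If `q` decomposes in a cubic field, the residue fields above `q` are `𝔽_q`, so that a cubic
polynomial with an integral root in the field has a root modulo `q`. -/
theorem exists_root_zmod_of_decomposes {K : Type*} [Field K] [NumberField K] [IsGalois ℚ K]
    {θ : K} (hθ : IsIntegral ℤ θ) {e₁ e₂ e₃ : ℤ} (h0 : (monicCubic (e₁ : K) e₂ e₃).eval θ = 0)
    {q : ℕ} [Fact q.Prime] (hq : Decomposes q K) :
    ∃ r : ZMod q, (monicCubic (e₁ : ZMod q) e₂ e₃).eval r = 0 := by
  obtain ⟨t, rfl⟩ : ∃ t : 𝓞 K, (t : K) = θ := ⟨⟨θ, hθ⟩, rfl⟩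
  have hqp := (Fact.out : q.Prime)
  have hmax : (Ideal.span {(q : ℤ)}).IsMaximal :=
    Int.ideal_span_isMaximal_of_prime q
  have hpos : 0 < ((Ideal.span {(q : ℤ)}).primesOver (𝓞 K)).ncard := by
    rw [hq]
    exact Module.finrank_pos
  have hmain := Ideal.ncard_primesOver_mul_ramificationIdxIn_mul_inertiaDegIn
    (Ideal.span {(q : ℤ)}) (𝓞 K) Gal(K/ℚ)
  rw [IsGaloisGroup.card_eq_finrank Gal(K/ℚ) ℚ K, hq,
    Nat.mul_eq_left Module.finrank_pos.ne'] at hmain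
  obtain ⟨P, hP, hPq⟩ := (Set.ncard_pos (Set.finite_of_ncard_pos hpos)).1 hpos
  have hdeg : P.inertiaDeg ℤ = 1 := by
    rw [← Ideal.inertiaDegIn_eq_inertiaDeg (Ideal.span {(q : ℤ)}) P Gal(K/ℚ)]
    exact Nat.eq_one_of_mul_eq_one_left hmain
  have hcard : Nat.card (𝓞 K ⧸ P) = q := by
    have h := Ideal.pow_inertiaDeg q P
    rw [hdeg, pow_one, Ideal.absNorm_apply, Submodule.cardQuot_apply] at h
    exact h.symm
  have hfin : Finite (𝓞 K ⧸ P) := Nat.finite_of_card_ne_zero (hcard.trans_ne hqp.ne_zero)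
  have := Fintype.ofFinite (𝓞 K ⧸ P)
  rw [Nat.card_eq_fintype_card] at hcard
  let E := ZMod.ringEquivOfPrime (𝓞 K ⧸ P) hqp hcard
  have hO : (monicCubic (e₁ : 𝓞 K) e₂ e₃).eval t = 0 := by
    apply NumberField.RingOfIntegers.coe_injective
    rw [eval_monicCubic] at h0 ⊢
    simpa using h0
  refine ⟨E.symm (Ideal.Quotient.mk P t), ?_⟩
  have := congrArg (fun x => E.symm (Ideal.Quotient.mk P x)) hO
  rw [eval_monicCubic] at this ⊢
  simpa using this

end Galois

end

/-! ### Reduction modulo `p` -/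

section Reduction

open MvPolynomial

variable {e₁ e₂ e₃ a₁ a₂ d₁ d₂ : ℤ}

/-- The equation of the surface with integral coefficients. -/
noncomputable def integralForm (e₁ e₂ e₃ a₁ a₂ d₁ d₂ : ℤ) : MvPolynomial (Fin 4) ℤ :=
  surfaceValue e₁ e₂ e₃ a₁ a₂ d₁ d₂ (X 0) (X 1) (X 2) (X 3)

theorem map_integralForm {R : Type*} [CommRing R] (φ : ℤ →+* R) :
    map φ (integralForm e₁ e₂ e₃ a₁ a₂ d₁ d₂) =
      surfaceValue e₁ e₂ e₃ a₁ a₂ d₁ d₂ (X 0) (X 1) (X 2) (X 3) := by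
  rw [integralForm, map_surfaceValue]
  simp

theorem surfaceForm_eq_surfaceValue {K : Type*} [Field K] [Algebra ℚ K] [FiniteDimensional ℚ K]
    [IsGalois ℚ K] {θ : K}
    (hN : normForm ℚ θ = cubicNorm (C (e₁ : ℚ)) (C (e₂ : ℚ)) (C (e₃ : ℚ)) (X 0) (X 1) (X 2)) :
    surfaceForm θ a₁ a₂ d₁ d₂ =
      surfaceValue e₁ e₂ e₃ a₁ a₂ d₁ d₂ (X 0) (X 1) (X 2) (X 3) := by
  rw [surfaceForm, hN, splitForm, surfaceValue]
  simp

theorem aeval_surfaceValue {A R : Type*} [CommRing A] [CommRing R] [Algebra A R] (t : Fin 4 → R) :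
    aeval t (surfaceValue e₁ e₂ e₃ a₁ a₂ d₁ d₂ (X 0) (X 1) (X 2) (X 3) : MvPolynomial (Fin 4) A) =
      surfaceValue e₁ e₂ e₃ a₁ a₂ d₁ d₂ (t 0) (t 1) (t 2) (t 3) := by
  have := map_surfaceValue (aeval t : MvPolynomial (Fin 4) A →ₐ[A] R).toRingHom
    e₁ e₂ e₃ a₁ a₂ d₁ d₂ (X 0) (X 1) (X 2) (X 3)
  simpa using this

theorem isPrimitiveModel_integralForm {F : MvPolynomial (Fin 4) ℚ}
    (hF : F = surfaceValue e₁ e₂ e₃ a₁ a₂ d₁ d₂ (X 0) (X 1) (X 2) (X 3)) :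
    IsPrimitiveModel F (integralForm e₁ e₂ e₃ a₁ a₂ d₁ d₂) := by
  refine ⟨by rw [map_integralForm, hF], fun n hn => ?_⟩
  have h := map_dvd (aeval ![1, 0, 0, 0] : MvPolynomial (Fin 4) ℤ →ₐ[ℤ] ℤ) hn
  rw [integralForm, aeval_surfaceValue] at h
  simp [surfaceValue, cubicNorm] at h
  exact isUnit_of_dvd_one h

theorem map_integralForm_of_cast_eq_zero {R : Type*} [CommRing R] (φ : ℤ →+* R)
    (h₁ : (e₁ : R) = 0) (h₂ : (e₂ : R) = 0) (h₃ : (e₃ : R) = 0) :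
    map φ (integralForm e₁ e₂ e₃ a₁ a₂ d₁ d₂) = splitForm R a₁ a₂ d₁ d₂ - X 0 ^ 3 := by
  rw [map_integralForm, surfaceValue, splitForm,
    ← map_intCast (C : R →+* MvPolynomial (Fin 4) R) e₁,
    ← map_intCast (C : R →+* MvPolynomial (Fin 4) R) e₂,
    ← map_intCast (C : R →+* MvPolynomial (Fin 4) R) e₃, h₁, h₂, h₃]
  simp [cubicNorm]

theorem natDegree_rootPoly_le (R : Type*) [CommRing R] :
    (rootPoly R a₁ a₂ d₁ d₂).natDegree ≤ 3 := by
  rw [rootPoly_eq_toPoly]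
  exact Polynomial.natDegree_cubic_le

theorem eval_rootPoly {R : Type*} [CommRing R] (s : R) :
    (rootPoly R a₁ a₂ d₁ d₂).eval s = s * (a₁ + d₁ * s) * (a₂ + d₂ * s) - 1 := by
  simp [rootPoly]

theorem eval_splitForm {R : Type*} [CommRing R] (t : Fin 4 → R) :
    eval t (splitForm R a₁ a₂ d₁ d₂) =
      t 3 * (a₁ * t 0 + d₁ * t 3) * (a₂ * t 0 + d₂ * t 3) := by
  simp [splitForm]

/-- The homogenization of the factorization of `T (a₁ + d₁ T) (a₂ + d₂ T) - 1` into linear factors;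
a degree drop gives factors `T₀`. -/
theorem splitForm_sub_eq_prod (k : Type*) [Field k] [IsAlgClosed k] :
    splitForm k a₁ a₂ d₁ d₂ - X 0 ^ 3 =
      C (rootPoly k a₁ a₂ d₁ d₂).leadingCoeff *
        X 0 ^ (3 - (rootPoly k a₁ a₂ d₁ d₂).natDegree) *
        ((rootPoly k a₁ a₂ d₁ d₂).roots.map fun s => X 3 - C s * X 0).prod := by
  have : Infinite k := IsAlgClosed.instInfinite
  -- Multiplication by `T₀` reduces the comparison of values to points with `T₀ ≠ 0`.
  refine mul_left_cancel₀ (X_ne_zero (0 : Fin 4)) (funext fun t => ?_)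
  simp only [map_mul, map_sub, map_pow, eval_X, eval_C, eval_splitForm, map_multiset_prod,
    Multiset.map_map, Function.comp_def]
  rcases eq_or_ne (t 0) 0 with h0 | h0
  · rw [h0, zero_mul, zero_mul]
  congr 1
  have hsplit := IsAlgClosed.splits (rootPoly k a₁ a₂ d₁ d₂)
  have hcard : (rootPoly k a₁ a₂ d₁ d₂).roots.card = (rootPoly k a₁ a₂ d₁ d₂).natDegree :=
    hsplit.natDegree_eq_card_roots.symm
  have heval := congrArg (Polynomial.eval (t 3 / t 0)) hsplit.eq_prod_roots
  rw [eval_rootPoly, Polynomial.eval_mul, Polynomial.eval_C, Polynomial.eval_multiset_prod,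
    Multiset.map_map] at heval
  simp only [Function.comp_def, Polynomial.eval_sub, Polynomial.eval_X, Polynomial.eval_C] at heval
  have hprod : ((rootPoly k a₁ a₂ d₁ d₂).roots.map fun s => t 3 - s * t 0).prod =
      t 0 ^ (rootPoly k a₁ a₂ d₁ d₂).natDegree *
        ((rootPoly k a₁ a₂ d₁ d₂).roots.map fun s => t 3 / t 0 - s).prod := by
    rw [← hcard]
    generalize (rootPoly k a₁ a₂ d₁ d₂).roots = m
    induction m using Multiset.induction with
    | empty => simp
    | cons s m ih =>
      rw [Multiset.map_cons, Multiset.prod_cons, Multiset.map_cons, Multiset.prod_cons,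
        Multiset.card_cons, ih, pow_succ]
      field_simp
  have hpow : t 0 ^ (3 - (rootPoly k a₁ a₂ d₁ d₂).natDegree) *
      t 0 ^ (rootPoly k a₁ a₂ d₁ d₂).natDegree = t 0 ^ 3 := by
    rw [← pow_add, Nat.sub_add_cancel (natDegree_rootPoly_le k)]
  calc _ = t 0 ^ 3 * (t 3 / t 0 * (a₁ + d₁ * (t 3 / t 0)) * (a₂ + d₂ * (t 3 / t 0)) - 1) := by
        field_simp
    _ = _ := by
        rw [heval, hprod, ← hpow]
        ring

theorem span_range_eq_top_iff {k ι : Type*} [Field k] {t : ι → k} :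
    Ideal.span (Set.range t) = ⊤ ↔ t ≠ 0 := by
  constructor
  · rintro h rfl
    have : Ideal.span (Set.range (0 : ι → k)) = ⊥ :=
      Ideal.span_eq_bot.2 (by rintro _ ⟨i, rfl⟩; rfl)
    exact bot_ne_top (this.symm.trans h)
  · intro h
    obtain ⟨i, hi⟩ := Function.ne_iff.1 h
    exact Ideal.eq_top_of_isUnit_mem _ (Ideal.subset_span ⟨i, rfl⟩) (isUnit_iff_ne_zero.2 hi)

/-- The reduction when no root lies at infinity. -/
theorem exists_three_planes {k : Type*} [Field k] [IsAlgClosed k] (hd : ((d₁ * d₂ : ℤ) : k) ≠ 0)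
    {G : MvPolynomial (Fin 4) ℤ}
    (hG : map (Int.castRingHom k) G = splitForm k a₁ a₂ d₁ d₂ - X 0 ^ 3) :
    ∃ s₁ s₂ s₃ : k, (rootPoly k a₁ a₂ d₁ d₂).roots = {s₁, s₂, s₃} ∧
      map (Int.castRingHom k) G = C ((d₁ * d₂ : ℤ) : k) * (X 3 - C s₁ * X 0) *
        (X 3 - C s₂ * X 0) * (X 3 - C s₃ * X 0) ∧
      coordinates G k =
        {t | t ≠ 0 ∧ (t 3 = s₁ * t 0 ∨ t 3 = s₂ * t 0 ∨ t 3 = s₃ * t 0)} := by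
  have hd' : (d₁ * d₂ : k) ≠ 0 := by exact_mod_cast hd
  have hdeg := Cubic.natDegree_of_a_ne_zero (P := ⟨(d₁ * d₂ : k), a₁ * d₂ + a₂ * d₁, a₁ * a₂, -1⟩)
    hd'
  have hlc := Cubic.leadingCoeff_of_a_ne_zero
    (P := ⟨(d₁ * d₂ : k), a₁ * d₂ + a₂ * d₁, a₁ * a₂, -1⟩) hd'
  rw [← rootPoly_eq_toPoly] at hdeg hlc
  have hsplit := IsAlgClosed.splits (rootPoly k a₁ a₂ d₁ d₂)
  obtain ⟨s₁, s₂, s₃, hs⟩ := Multiset.card_eq_three.1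
    (hsplit.natDegree_eq_card_roots.symm.trans hdeg)
  have hform : map (Int.castRingHom k) G = C ((d₁ * d₂ : ℤ) : k) * (X 3 - C s₁ * X 0) *
      (X 3 - C s₂ * X 0) * (X 3 - C s₃ * X 0) := by
    rw [hG, splitForm_sub_eq_prod, hdeg, hlc, hs]
    simp
    ring
  refine ⟨s₁, s₂, s₃, hs, hform, Set.ext fun t => ?_⟩
  have haeval : aeval t G = eval t (map (Int.castRingHom k) G) := by
    rw [eval_map, aeval_def, algebraMap_int_eq]
  simp only [coordinates, Set.mem_ofPred_eq, span_range_eq_top_iff, haeval, hform]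
  simp only [map_mul, map_sub, eval_C, eval_X, mul_eq_zero, hd, false_or, sub_eq_zero, or_assoc]

end Reduction

/-! ### Rational points and local points of the surface -/

section RationalPoints

open MvPolynomial

variable {p : ℕ} [Fact p.Prime] {e₁ e₂ e₃ a₁ a₂ d₁ d₂ : ℤ}

theorem surfaceValue_mul {R : Type*} [CommRing R] (c x y z w : R) :
    surfaceValue e₁ e₂ e₃ a₁ a₂ d₁ d₂ (c * x) (c * y) (c * z) (c * w) =
      c ^ 3 * surfaceValue e₁ e₂ e₃ a₁ a₂ d₁ d₂ x y z w := by
  simp only [surfaceValue, cubicNorm]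
  ring

theorem ratCast_zmod_eq_div {r : ℚ} {x w : ℤ} (hx : ¬ (p : ℤ) ∣ x) (hr : r = w / x) :
    ¬ p ∣ r.den ∧ (r : ZMod p) = (w : ZMod p) / x := by
  have hden : ¬ p ∣ r.den := fun h =>
    hx ((Int.natCast_dvd_natCast.2 h).trans
      (by rw [hr, ← Rat.divInt_eq_div]; exact Rat.den_dvd w x))
  refine ⟨hden, ?_⟩
  have hx0 : (x : ℚ) ≠ 0 := by
    rintro h
    exact hx (by simp [Int.cast_eq_zero.1 h])
  have hx' : (x : ZMod p) ≠ 0 := by rwa [Ne, ZMod.intCast_zmod_eq_zero_iff_dvd]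
  have hden' : (r.den : ZMod p) ≠ 0 := by rwa [Ne, ZMod.natCast_eq_zero_iff]
  have hden0 : (r.den : ℚ) ≠ 0 := Nat.cast_ne_zero.2 r.den_ne_zero
  have key : r.num * x = w * r.den := by
    have h : (r.num : ℚ) * x = w * r.den := by
      rw [← div_eq_div_iff hden0 hx0, Rat.num_div_den, hr]
    exact_mod_cast h
  rw [Rat.cast_def, div_eq_div_iff hden' hx']
  exact_mod_cast congrArg (Int.cast : ℤ → ZMod p) key

/-- The reduction at `p` of a rational point, in terms of primitive integral coordinates. -/
theorem rational_point_of_isPeriodCubic {e : ℕ} {g₁ g₂ g₃ : (ZMod p)ˣ}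
    (h : IsPeriodCubic e g₁ g₂ g₃ e₁ e₂ e₃) (he : 3 * e = p - 1) (he₃ : ¬ (p : ℤ) ^ 2 ∣ e₃)
    (hd : ¬ (p : ℤ) ∣ d₁ * d₂) (hgcd : Int.gcd d₁ d₂ = 1) {F : MvPolynomial (Fin 4) ℚ}
    (hF : F = surfaceValue e₁ e₂ e₃ a₁ a₂ d₁ d₂ (X 0) (X 1) (X 2) (X 3))
    {t : Fin 4 → ℚ} (ht : t ∈ coordinates F ℚ) :
    t 0 ≠ 0 ∧ ¬ p ∣ (t 3 / t 0).den ∧ ∀ s : ZMod p, s = ((t 3 / t 0 : ℚ) : ZMod p) →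
      s ≠ 0 ∧ (rootPoly (ZMod p) a₁ a₂ d₁ d₂).IsRoot s ∧
      ∃ c : (ZMod p)ˣ, ((a₁ : ZMod p) + d₁ * s) / s = (c : ZMod p) ^ 3 := by
  obtain ⟨hspan, hval⟩ := ht
  obtain ⟨c, u, hc, hu, hprim⟩ := exists_primitive_coordinates (span_range_eq_top_iff.1 hspan)
  rw [hF, aeval_surfaceValue, hu, hu, hu, hu, surfaceValue_mul] at hval
  have hval' : surfaceValue e₁ e₂ e₃ a₁ a₂ d₁ d₂ (u 0) (u 1) (u 2) (u 3) = 0 := by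
    have := (mul_eq_zero.1 hval).resolve_left (pow_ne_zero 3 hc)
    rw [← Int.cast_eq_zero (α := ℚ), ← this]
    exact map_surfaceValue (Int.castRingHom ℚ) _ _ _ _ _ _ _ _ _ _ _
  have hprim' : ∀ q : ℕ, q.Prime →
      ¬ ((q : ℤ) ∣ u 0 ∧ (q : ℤ) ∣ u 1 ∧ (q : ℤ) ∣ u 2 ∧ (q : ℤ) ∣ u 3) := by
    rintro q hq ⟨h0, h1, h2, h3⟩
    obtain ⟨i, hi⟩ := hprim q hq
    fin_cases i
    exacts [hi h0, hi h1, hi h2, hi h3]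
  have hpp := (Fact.out : p.Prime)
  obtain ⟨h₁, h₂, h₃⟩ := h.dvd
  have hx := not_dvd_of_eisenstein (Nat.prime_iff_prime_int.1 hpp) h₁ h₂ h₃ he₃ hd hval'
    (hprim' p hpp)
  have hu0 : (u 0 : ℚ) ≠ 0 := by
    intro h0
    exact hx (by simp [Int.cast_eq_zero.1 h0])
  obtain ⟨hden, hcast⟩ := ratCast_zmod_eq_div (r := t 3 / t 0) hx
    (by rw [hu, hu, mul_div_mul_left _ _ hc])
  refine ⟨by rw [hu]; exact mul_ne_zero hc hu0, hden, ?_⟩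
  rintro s rfl
  obtain ⟨hroot, hcube⟩ := cube_of_primitive_point he h₁ h₂ h₃
    (fun q _ hqp hq => h.eval_ne_zero he hqp hq) hgcd hval' hprim' hx
  rw [hcast]
  refine ⟨fun h0 => ?_, hroot, hcube⟩
  rw [h0, eval_rootPoly] at hroot
  simp at hroot

/-- Local solubility at all primes: at `p` by the simple zero; at the cubes modulo `p` on `T₃ = 0`;
at the other primes because the cubic is irreducible there, which by `h₁`, `h₂` also excludes common
prime factors of `aᵢ` and `dᵢ`. -/
theorem hasPoint_padicInt_of_isPeriodCubic {e : ℕ} {g₁ g₂ g₃ : (ZMod p)ˣ}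
    (h : IsPeriodCubic e g₁ g₂ g₃ e₁ e₂ e₃) (he : 3 * e = p - 1)
    (h₁ : ∀ (q : ℕ) [Fact q.Prime], (a₁ : ZMod q) = 0 → (d₁ : ZMod q) = 0 →
      ∃ r : ZMod q, (monicCubic (e₁ : ZMod q) e₂ e₃).eval r = 0)
    (h₂ : ∀ (q : ℕ) [Fact q.Prime], (a₂ : ZMod q) = 0 → (d₂ : ZMod q) = 0 →
      ∃ r : ZMod q, (monicCubic (e₁ : ZMod q) e₂ e₃).eval r = 0)
    (hs : ∃ s : ZMod p, (rootPoly (ZMod p) a₁ a₂ d₁ d₂).rootMultiplicity s = 1)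
    (q : ℕ) [Fact q.Prime] : HasPoint ℤ_[q] e₁ e₂ e₃ a₁ a₂ d₁ d₂ := by
  rcases eq_or_ne q p with rfl | hqp
  · obtain ⟨s, hs⟩ := hs
    have h0 : rootPoly (ZMod q) a₁ a₂ d₁ d₂ ≠ 0 := by
      intro h0
      simp [h0] at hs
    have hroot : (rootPoly (ZMod q) a₁ a₂ d₁ d₂).IsRoot s :=
      (Polynomial.rootMultiplicity_pos h0).1 (by omega)
    refine hasPoint_padicInt_of_simple_root hroot fun hder => ?_
    have := (Polynomial.one_lt_rootMultiplicity_iff_isRoot h0).2 ⟨hroot, hder⟩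
    omega
  by_cases hq : (q : ZMod p) ^ e = 1
  · obtain ⟨r, hr⟩ := h.exists_padicInt_root hqp hq
    exact hasPoint_padicInt_of_root hr
  · have hf := h.eval_ne_zero he hqp hq
    refine hasPoint_padicInt_of_irreducible hf ?_ ?_
    · rintro ⟨ha, hd⟩
      obtain ⟨r, hr⟩ := h₁ q ha hd
      exact hf r hr
    · rintro ⟨ha, hd⟩
      obtain ⟨r, hr⟩ := h₂ q ha hd
      exact hf r hr

theorem HasPoint.points_nonempty {R : Type*} [CommRing R] [Algebra ℚ R]
    (h : HasPoint R e₁ e₂ e₃ a₁ a₂ d₁ d₂) {F : MvPolynomial (Fin 4) ℚ}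
    (hF : F = surfaceValue e₁ e₂ e₃ a₁ a₂ d₁ d₂ (X 0) (X 1) (X 2) (X 3)) :
    (points F R).Nonempty := by
  obtain ⟨t, c, h1, h2⟩ := h
  refine ⟨_, t, ⟨(Ideal.eq_top_iff_one _).2 ?_, ?_⟩, rfl⟩
  · rw [← h1]
    exact Ideal.sum_mem _ fun i _ => Ideal.mul_mem_left _ _ (Ideal.subset_span ⟨i, rfl⟩)
  · rw [hF, aeval_surfaceValue, h2]

theorem points_eq_empty {R A : Type*} [CommRing R] [CommRing A] [Algebra A R]
    {F : MvPolynomial (Fin 4) A} (h : ∀ t, t ∉ coordinates F R) : points F R = ∅ := by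
  rw [points, Set.eq_empty_of_forall_notMem h, Set.image_empty]

end RationalPoints

end MordellSurface

theorem theorem1 (p : ℕ) [Fact p.Prime] (hp : p % 3 = 1)
    (ζ : CyclotomicField p ℚ) (hζ : IsPrimitiveRoot ζ p)
    (K : IntermediateField ℚ (CyclotomicField p ℚ)) (hK : Module.finrank ℚ K = 3)
    (θ : K) (hθ : θ = Algebra.trace K (CyclotomicField p ℚ) (ζ - 1))
    (a₁ a₂ d₁ d₂ : ℤ) (F : MvPolynomial (Fin 4) ℚ)
    (hF : F = MordellSurface.surfaceForm θ a₁ a₂ d₁ d₂) :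
    -- the reduction at `p`
    (∃ G : MvPolynomial (Fin 4) ℤ, MordellSurface.IsPrimitiveModel F G ∧
      G.map (Int.castRingHom (ZMod p)) =
        MordellSurface.splitForm (ZMod p) a₁ a₂ d₁ d₂ - MvPolynomial.X 0 ^ 3 ∧
      -- over the algebraic closure, for arbitrary coefficients: a root at infinity of the cubic
      -- corresponds to the plane `T₀ = 0`
      G.map (Int.castRingHom (AlgebraicClosure (ZMod p))) =
        MvPolynomial.C
            (MordellSurface.rootPoly (AlgebraicClosure (ZMod p)) a₁ a₂ d₁ d₂).leadingCoeff *
          MvPolynomial.X 0 ^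
            (3 - (MordellSurface.rootPoly (AlgebraicClosure (ZMod p)) a₁ a₂ d₁ d₂).natDegree) *
          ((MordellSurface.rootPoly (AlgebraicClosure (ZMod p)) a₁ a₂ d₁ d₂).roots.map
            fun s => MvPolynomial.X 3 - MvPolynomial.C s * MvPolynomial.X 0).prod ∧
      -- over the algebraic closure, when there is no root at infinity
      (¬ (p : ℤ) ∣ d₁ * d₂ → ∃ s₁ s₂ s₃ : AlgebraicClosure (ZMod p),
        (MordellSurface.rootPoly (AlgebraicClosure (ZMod p)) a₁ a₂ d₁ d₂).roots = {s₁, s₂, s₃} ∧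
        G.map (Int.castRingHom (AlgebraicClosure (ZMod p))) =
          MvPolynomial.C ((d₁ * d₂ : ℤ) : AlgebraicClosure (ZMod p)) *
            (MvPolynomial.X 3 - MvPolynomial.C s₁ * MvPolynomial.X 0) *
            (MvPolynomial.X 3 - MvPolynomial.C s₂ * MvPolynomial.X 0) *
            (MvPolynomial.X 3 - MvPolynomial.C s₃ * MvPolynomial.X 0) ∧
        MordellSurface.coordinates G (AlgebraicClosure (ZMod p)) =
          {t | t ≠ 0 ∧ (t 3 = s₁ * t 0 ∨ t 3 = s₂ * t 0 ∨ t 3 = s₃ * t 0)})) ∧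
    -- the rational points
    (¬ (p : ℤ) ∣ d₁ * d₂ → Int.gcd d₁ d₂ = 1 →
      (∀ t ∈ MordellSurface.coordinates F ℚ,
        t 0 ≠ 0 ∧ ¬ p ∣ (t 3 / t 0).den ∧
        ∀ s : ZMod p, s = ((t 3 / t 0 : ℚ) : ZMod p) →
          s ≠ 0 ∧ (MordellSurface.rootPoly (ZMod p) a₁ a₂ d₁ d₂).IsRoot s ∧
          ∃ c : (ZMod p)ˣ, ((a₁ : ZMod p) + d₁ * s) / s = (c : ZMod p) ^ 3) ∧
      ((∀ s : ZMod p, (MordellSurface.rootPoly (ZMod p) a₁ a₂ d₁ d₂).IsRoot s →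
          ¬ ∃ c : (ZMod p)ˣ, ((a₁ : ZMod p) + d₁ * s) / s = (c : ZMod p) ^ 3) →
        MordellSurface.points F ℚ = ∅)) ∧
    -- the adelic points
    (¬ (p : ℤ) ∣ d₁ * d₂ →
      (∀ q : ℕ, q.Prime → q ∣ Int.gcd a₁ d₁ → MordellSurface.Decomposes q K) →
      (∀ q : ℕ, q.Prime → q ∣ Int.gcd a₂ d₂ → MordellSurface.Decomposes q K) →
      (∃ s : ZMod p, (MordellSurface.rootPoly (ZMod p) a₁ a₂ d₁ d₂).rootMultiplicity s = 1) →
      (MordellSurface.points F (NumberField.AdeleRing ℤ ℚ)).Nonempty) ∧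
    -- the counterexamples to the Hasse principle
    (¬ (p : ℤ) ∣ d₁ * d₂ → Int.gcd d₁ d₂ = 1 →
      (∀ q : ℕ, q.Prime → q ∣ Int.gcd a₁ d₁ → MordellSurface.Decomposes q K) →
      (∀ q : ℕ, q.Prime → q ∣ Int.gcd a₂ d₂ → MordellSurface.Decomposes q K) →
      (∃ s : ZMod p, (MordellSurface.rootPoly (ZMod p) a₁ a₂ d₁ d₂).rootMultiplicity s = 1) →
      (∀ s : ZMod p, (MordellSurface.rootPoly (ZMod p) a₁ a₂ d₁ d₂).IsRoot s →
          ¬ ∃ c : (ZMod p)ˣ, ((a₁ : ZMod p) + d₁ * s) / s = (c : ZMod p) ^ 3) →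
      (MordellSurface.points F (NumberField.AdeleRing ℤ ℚ)).Nonempty ∧
        MordellSurface.points F ℚ = ∅) := by
  have hne : NeZero (p : ℚ) := ⟨Nat.cast_ne_zero.2 (Fact.out : p.Prime).ne_zero⟩
  have hcyc : IsCyclotomicExtension {p} ℚ (CyclotomicField p ℚ) :=
    CyclotomicField.isCyclotomicExtension p ℚ
  have hnf := IsCyclotomicExtension.numberField {p} ℚ (CyclotomicField p ℚ)
  have he : 3 * ((p - 1) / 3) = p - 1 := by omega
  obtain ⟨g₁, g₂, g₃, e₁, e₂, e₃, h, hN, hroot, hint⟩ :=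
    MordellSurface.exists_isPeriodCubic hp hζ hK hθ
  have he₃ : ¬ (p : ℤ) ^ 2 ∣ e₃ := h.not_sq_dvd he hζ
  rw [MordellSurface.surfaceForm_eq_surfaceValue hN] at hF
  have hcast : ∀ {R : Type} [CommRing R] [CharP R p] {n : ℤ}, (p : ℤ) ∣ n → (n : R) = 0 :=
    fun hn => (CharP.intCast_eq_zero_iff _ p _).2 hn
  obtain ⟨h₁, h₂, h₃⟩ := h.dvd
  have hrat := fun (hd : ¬ (p : ℤ) ∣ d₁ * d₂) (hgcd : Int.gcd d₁ d₂ = 1)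
      (t : Fin 4 → ℚ) (ht : t ∈ MordellSurface.coordinates F ℚ) =>
    MordellSurface.rational_point_of_isPeriodCubic h he he₃ hd hgcd hF ht
  have hempty : ¬ (p : ℤ) ∣ d₁ * d₂ → Int.gcd d₁ d₂ = 1 →
      (∀ s : ZMod p, (MordellSurface.rootPoly (ZMod p) a₁ a₂ d₁ d₂).IsRoot s →
        ¬ ∃ c : (ZMod p)ˣ, ((a₁ : ZMod p) + d₁ * s) / s = (c : ZMod p) ^ 3) →
      MordellSurface.points F ℚ = ∅ := by
    refine fun hd hgcd hcube => MordellSurface.points_eq_empty fun t ht => ?_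
    obtain ⟨-, -, hs⟩ := hrat hd hgcd t ht
    obtain ⟨-, hs₁, hs₂⟩ := hs _ rfl
    exact hcube _ hs₁ hs₂
  have hdec : ∀ {a d : ℤ}, (∀ q : ℕ, q.Prime → q ∣ Int.gcd a d → MordellSurface.Decomposes q K) →
      ∀ (q : ℕ) [Fact q.Prime], (a : ZMod q) = 0 → (d : ZMod q) = 0 →
        ∃ r : ZMod q, (MordellSurface.monicCubic (e₁ : ZMod q) e₂ e₃).eval r = 0 := by
    intro a d hdec q _ ha hd
    rw [ZMod.intCast_zmod_eq_zero_iff_dvd] at ha hd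
    exact MordellSurface.exists_root_zmod_of_decomposes hint hroot
      (hdec q Fact.out (Int.natCast_dvd_natCast.1 (Int.dvd_coe_gcd ha hd)))
  have hadele : ¬ (p : ℤ) ∣ d₁ * d₂ →
      (∀ q : ℕ, q.Prime → q ∣ Int.gcd a₁ d₁ → MordellSurface.Decomposes q K) →
      (∀ q : ℕ, q.Prime → q ∣ Int.gcd a₂ d₂ → MordellSurface.Decomposes q K) →
      (∃ s : ZMod p, (MordellSurface.rootPoly (ZMod p) a₁ a₂ d₁ d₂).rootMultiplicity s = 1) →
      (MordellSurface.points F (NumberField.AdeleRing ℤ ℚ)).Nonempty := by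
    intro hd hq₁ hq₂ hs
    have hd0 : d₁ * d₂ ≠ 0 := fun h0 => hd (by rw [h0]; exact dvd_zero _)
    exact (MordellSurface.hasPoint_adeleRing hd0 fun q _ =>
      MordellSurface.hasPoint_padicInt_of_isPeriodCubic h he (hdec hq₁) (hdec hq₂) hs
        q).points_nonempty hF
  refine ⟨⟨MordellSurface.integralForm e₁ e₂ e₃ a₁ a₂ d₁ d₂,
    MordellSurface.isPrimitiveModel_integralForm hF,
    MordellSurface.map_integralForm_of_cast_eq_zero _ (hcast h₁) (hcast h₂) (hcast h₃),
    ?_, fun hd => ?_⟩,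
    fun hd hgcd => ⟨hrat hd hgcd, hempty hd hgcd⟩, hadele,
    fun hd hgcd hq₁ hq₂ hs hcube => ⟨hadele hd hq₁ hq₂ hs, hempty hd hgcd hcube⟩⟩
  · rw [MordellSurface.map_integralForm_of_cast_eq_zero _ (hcast h₁) (hcast h₂) (hcast h₃)]
    exact MordellSurface.splitForm_sub_eq_prod _
  · refine MordellSurface.exists_three_planes ?_
      (MordellSurface.map_integralForm_of_cast_eq_zero _ (hcast h₁) (hcast h₂) (hcast h₃))
    rwa [Ne, CharP.intCast_eq_zero_iff _ p]
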